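/- **Setting.** Let $p\ge 1$, let $g:\mathbb R^n\times\mathbb R^m\to\mathbb R$ be $p$ times and twice continuously differentiable, $z=(x,y)$, $F(z)=(\nabla_x g(z),-\nabla_y g(z))$, $m(z)=\frac12\|F(z)\|^2$, all norms Euclidean (operator norms for derivatives). Let $\mu,L_1,L_2,L_p>0$ with $\mu^2<L_1L_2$, and suppose that $g$ is $\mu$-strongly convex in $x$ and $\mu$-strongly concave in $y$, and that for all $z,z'$: $\|F(z)-F(z')\|\le L_1\|z-z'\|$, $\|\nabla F(z)-\nabla F(z')\|\le L_2\|z-z'\|$, $\|\nabla^{p-1}F(z)-\nabla^{p-1}F(z')\|\le L_p\|z-z'\|$. Let $z^*$ be the saddle point of $g$ ($\min_x\max_y g$), $R>0$ with $R\ge\|z_1-z^*\|$, $\xi=\max\{1,L_1/\mu\}$, $0<\varepsilon_G<1$, $\rho,\alpha\in(0,1)$. The duality gap is $G(x,y)=\max_{y'}g(x,y')-\min_{x'}g(x',y)$. **HighOrderMirrorProx** from $z_1$ with $T$ iterations: for $t=1,\dots,T$ determine $\gamma_t,\hat z_t,z_{t+1}$ such that $$\hat z_t=\arg\min_z\{\gamma_t\langle\Phi_{z_t}(\hat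 z_t),z-z_t\rangle+\tfrac12\|z-z_t\|^2\},\quad \frac{p!}{32L_p\|\hat z_t-z_t\|^{p-1}}\le\gamma_t\le\frac{p!}{16L_p\|\hat z_t-z_t\|^{p-1}},$$ $$z_{t+1}=\arg\min_z\{\gamma_t\langle F(\hat z_t),z-\hat z_t\rangle+\tfrac12\|z-z_t\|^2\},$$ where $\Phi_{z}(\hat z)=\sum_{i=0}^{p-1}\frac1{i!}\nabla^iF(z)[\hat z-z]^i$; the output is $\sum_t\gamma_t\hat z_t/\sum_t\gamma_t$. (If $F(z_t)=0$ for some $t\le T$, then $z_t=z^*$ may be returned.) **CRN-SPP** from $w_0$ with accuracy $\tilde\varepsilon$ and parameter $\bar\gamma$: while $m(w_k)>\tilde\varepsilon$, let $\gamma_k$ be the first of $\bar\gamma,\rho\bar\gamma,\rho^2\bar\gamma,\dots$ for which the solution $(\tilde x,\tilde y)$ of $$\min_x\max_y\; g(w_k)+\langle\nabla g(w_k),z-w_k\rangle+\tfrac12\nabla^2g(w_k)[z-w_k]^2+\tfrac{\gamma_k}3\|x-x_k\|^3-\tfrac{\gamma_k}3\|y-y_k\|^3,\qquad w_k=(x_k,y_k),$$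 satisfies $\gamma_k(\|\tilde x-x_k\|+\|\tilde y-y_k\|)\le\mu$; put $d_k=(\tilde x-x_k,\tilde y-y_k)$ and $w_{k+1}=w_k+\alpha d_k$ if $m(w_k+\alpha d_k)<m(w_k+d_k)$, $w_{k+1}=w_k+d_k$ otherwise. **Method.** Put $\tilde z_1=z_1$. For $i=1,\dots,N_0$, $N_0=\max\{0,\lceil\log_2\frac{L_2R\xi}{\mu}+1\rceil\}$, let $\tilde z_{i+1}$ be the output of HighOrderMirrorProx from $\tilde z_i$ with $T_i=\big\lceil\big(\frac{64L_pR_i^{p-1}}{\mu}\big)^{2/(p+1)}\big\rceil$ iterations, $R_i=R/2^{i-1}$. Then run CRN-SPP from $\tilde z_{N_0+1}$ with $\tilde\varepsilon=\mu^2\varepsilon_G/L_1$ and $\bar\gamma=\frac{L_2\mu^2}{2L_1^2}$. **Theorem.** For every run of the restarts, $\|\tilde z_{N_0+1}-z^*\|\le\frac{\mu}{L_2\xi}$. The CRN-SPP phase can always be continued until it stops, and when it stops its last point has duality gap at most $\varepsilon_G$. The total number $\sum_{i=1}^{N_0}T_i+k$ of iterations ($k$ being the number of iterations of CRN-SPP)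 is, as $\varepsilon_G\to0$, $$O\left(\Big(\frac{L_pR^{p-1}}{\mu}\Big)^{\frac2{p+1}}\log\frac{L_2\xi R}{\mu}+\log\frac{\log\frac{L_1^3}{2\mu^2\varepsilon_G}}{\log\frac{L_1L_2}{\mu^2}}\right),$$ with the following meaning: there is an absolute constant $K$ and for all $\mu,L_1,L_2$ as above there is $\varepsilon_0>0$, depending on $\mu,L_1,L_2$ only, such that for all $\varepsilon_G\le\varepsilon_0$ and all $n,m,p,L_p,R,g,z_1,\rho,\alpha$ as above the number is at most $K$ times the expression in the parentheses; here each of the two factors $\big(\frac{L_pR^{p-1}}{\mu}\big)^{2/(p+1)}$ and $\log_2\frac{L_2\xi R}{\mu}$ is to be replaced by $1$ if it is smaller than $1$. -/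

import Mathlib

open scoped BigOperators

namespace TensorSPP

noncomputable section

/-- `ℝⁿ` with the Euclidean norm. -/
abbrev Vec (n : ℕ) : Type := EuclideanSpace ℝ (Fin n)

/-- `ℝⁿ × ℝᵐ` with the Euclidean norm `‖(x, y)‖² = ‖x‖² + ‖y‖²`. -/
abbrev Pt (n m : ℕ) : Type := WithLp 2 (Vec n × Vec m)

/-- The point `z = (x, y)`. -/
abbrev pt {n m : ℕ} (x : Vec n) (y : Vec m) : Pt n m := WithLp.toLp 2 (x, y)

/-- The partial gradient `∇ₓ g(x, y)`. -/
def gradX {n m : ℕ} (g : Pt n m → ℝ) (z : Pt n m) : Vec n :=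
  gradient (fun x : Vec n => g (pt x z.snd)) z.fst

/-- The partial gradient `∇_y g(x, y)`. -/
def gradY {n m : ℕ} (g : Pt n m → ℝ) (z : Pt n m) : Vec m :=
  gradient (fun y : Vec m => g (pt z.fst y)) z.snd

/-- The saddle operator `F(x, y) = (∇ₓ g(x, y), -∇_y g(x, y))`. -/
def saddleOp {n m : ℕ} (g : Pt n m → ℝ) (z : Pt n m) : Pt n m :=
  pt (gradX g z) (-gradY g z)

/-- `g` is `μ`-strongly convex in `x` and `μ`-strongly concave in `y` (gradient form). -/
def StronglyConvexConcave {n m : ℕ} (μ : ℝ) (g : Pt n m → ℝ) : Prop :=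
  (∀ (x₁ x₂ : Vec n) (y : Vec m),
    μ * ‖x₁ - x₂‖ ^ 2 ≤ inner ℝ (gradX g (pt x₁ y) - gradX g (pt x₂ y)) (x₁ - x₂)) ∧
  (∀ (x : Vec n) (y₁ y₂ : Vec m),
    μ * ‖y₁ - y₂‖ ^ 2 ≤ inner ℝ (-gradY g (pt x y₁) + gradY g (pt x y₂)) (y₁ - y₂))

/-- `q`-th order Lipschitz condition for an operator `F` (for `q ≥ 1`): the derivative of order
`q - 1` of `F` is Lipschitz, in the operator norm of multilinear maps, with constant `L`. -/
def OrderLipschitz {n m : ℕ} (q : ℕ) (L : ℝ) (F : Pt n m → Pt n m) : Prop :=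
  ∀ z₁ z₂ : Pt n m,
    ‖iteratedFDeriv ℝ (q - 1) F z₁ - iteratedFDeriv ℝ (q - 1) F z₂‖ ≤ L * ‖z₁ - z₂‖

/-- `z = (x, y)` solves `min_x max_y h(x, y)`, i.e. it is a saddle point of `h`. -/
def IsSaddlePoint {n m : ℕ} (h : Pt n m → ℝ) (z : Pt n m) : Prop :=
  (∀ y' : Vec m, h (pt z.fst y') ≤ h z) ∧ (∀ x' : Vec n, h z ≤ h (pt x' z.snd))

/-- `G` is the duality gap `max_{y'} g(x, y') - min_{x'} g(x', y)` at `z = (x, y)`;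
the maximum and the minimum are required to be attained. -/
def IsDualityGap {n m : ℕ} (g : Pt n m → ℝ) (z : Pt n m) (G : ℝ) : Prop :=
  ∃ a b : ℝ, IsGreatest (Set.range fun y' : Vec m => g (pt z.fst y')) a ∧
    IsLeast (Set.range fun x' : Vec n => g (pt x' z.snd)) b ∧ G = a - b

/-- The merit function `m(z) = ½ ‖F(z)‖²`. -/
def merit {n m : ℕ} (g : Pt n m → ℝ) (z : Pt n m) : ℝ := (1 / 2) * ‖saddleOp g z‖ ^ 2

/-- Taylor approximation of `f` at `z` up to the order `q`. -/
def taylorApprox {E V : Type*} [NormedAddCommGroup E] [NormedSpace ℝ E]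
    [NormedAddCommGroup V] [NormedSpace ℝ V] (f : E → V) (q : ℕ) (z w : E) : V :=
  ∑ i ∈ Finset.range (q + 1), (1 / (i.factorial : ℝ)) • iteratedFDeriv ℝ i f z (fun _ => w - z)

/-- The Bregman divergence `D(z, w) = ½ ‖z - w‖²`. -/
def bregman {n m : ℕ} (z w : Pt n m) : ℝ := (1 / 2) * ‖z - w‖ ^ 2

/-- One iteration `z ↦ z'` of HighOrderMirrorProx, with step size `γ` and intermediate point `zh`.
The condition `p!/(32 Lp ‖zh - z‖^(p-1)) ≤ γ ≤ p!/(16 Lp ‖zh - z‖^(p-1))` is written with the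
denominators multiplied out. `F` is `p - 1` times differentiable, and its Taylor approximation has
this order (order `0`, that is Mirror-Prox, for `p = 1`). -/
def MirrorProxStep {n m : ℕ} (F : Pt n m → Pt n m) (p : ℕ) (Lp : ℝ)
    (z : Pt n m) (γ : ℝ) (zh z' : Pt n m) : Prop :=
  IsMinOn (fun u => γ * inner ℝ (taylorApprox F (p - 1) z zh) (u - z) + bregman u z)
    Set.univ zh ∧
  (p.factorial : ℝ) / 32 ≤ γ * (Lp * ‖zh - z‖ ^ (p - 1)) ∧
  γ * (Lp * ‖zh - z‖ ^ (p - 1)) ≤ (p.factorial : ℝ) / 16 ∧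
  IsMinOn (fun u => inner ℝ (γ • F zh) (u - zh) + bregman u z) Set.univ z'

/-- `out` is an output of HighOrderMirrorProx run from `z₁` for `T` iterations: the `γ`-weighted
average of the intermediate points. If an iterate `z τ` satisfies `F (z τ) = 0`, it is the exact
solution; the prescribed step size would be infinite (for `p ≥ 2`), and the iterate is returned. -/
def MirrorProxOutput {n m : ℕ} (F : Pt n m → Pt n m) (p : ℕ) (Lp : ℝ) (T : ℕ)
    (z₁ out : Pt n m) : Prop :=
  ∃ (z zh : ℕ → Pt n m) (γ : ℕ → ℝ), z 0 = z₁ ∧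
    (((∀ t < T, MirrorProxStep F p Lp (z t) (γ t) (zh t) (z (t + 1))) ∧
        out = (∑ t ∈ Finset.range T, γ t)⁻¹ • ∑ t ∈ Finset.range T, γ t • zh t) ∨
      (∃ τ < T, (∀ t < τ, MirrorProxStep F p Lp (z t) (γ t) (zh t) (z (t + 1))) ∧
        F (z τ) = 0 ∧ out = z τ))

/-- Number of iterations `⌈(64 Lp Rᵢ^(p-1) / μ)^(2/(p+1))⌉` in the restart number `i`
(counted from `0`), where `Rᵢ = R / 2^i`. -/
def restartLength (p : ℕ) (Lp μ R : ℝ) (i : ℕ) : ℕ :=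
  ⌈(64 * Lp * (R / 2 ^ i) ^ (p - 1) / μ) ^ (2 / ((p : ℝ) + 1))⌉₊

/-- `ξ = max {1, L₁ / μ}`. -/
def xi (μ L₁ : ℝ) : ℝ := max 1 (L₁ / μ)

/-- Number of restarts `⌈log₂ (L₂ R ξ / μ) + 1⌉` (no restart if this is negative). -/
def numRestarts (μ L₁ L₂ R : ℝ) : ℕ := ⌈Real.logb 2 (L₂ * R * xi μ L₁ / μ) + 1⌉₊

/-- `zt 0, …, zt N` are the points of `N` restarts of HighOrderMirrorProx from `zt 0 = z₁`. -/
def IsRestartRun {n m : ℕ} (F : Pt n m → Pt n m) (p : ℕ) (Lp μ R : ℝ) (N : ℕ) (z₁ : Pt n m)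
    (zt : ℕ → Pt n m) : Prop :=
  zt 0 = z₁ ∧ ∀ i < N, MirrorProxOutput F p Lp (restartLength p Lp μ R i) (zt i) (zt (i + 1))

/-- The cubic-regularized quadratic model of `g` at `w`,
`g(w) + ⟨∇g(w), z - w⟩ + ½ ∇²g(w)[z - w]² + (γ/3) ‖x - x_w‖³ - (γ/3) ‖y - y_w‖³`. -/
def cubicModel {n m : ℕ} (g : Pt n m → ℝ) (w : Pt n m) (γ : ℝ) (z : Pt n m) : ℝ :=
  taylorApprox g 2 w z + γ / 3 * ‖z.fst - w.fst‖ ^ 3 - γ / 3 * ‖z.snd - w.snd‖ ^ 3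

/-- One iteration `w ↦ w'` of CRN-SPP. The inner loop starts with `γ = γbar`, solves the cubic
subproblem (solution `s i` in the trial `i`), and multiplies `γ` by `ρ` as long as
`γ (‖dx‖ + ‖dy‖) > μ`; the trial `j` is the first one that is accepted. Then the step `α d` is taken
if it has a smaller merit than the full step `d`, and the full step otherwise. -/
def CRNStep {n m : ℕ} (g : Pt n m → ℝ) (μ γbar ρ α : ℝ) (w w' : Pt n m) : Prop :=
  ∃ (j : ℕ) (s : ℕ → Pt n m),
    (∀ i ≤ j, IsSaddlePoint (cubicModel g w (ρ ^ i * γbar)) (s i)) ∧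
    (∀ i < j, μ < ρ ^ i * γbar * (‖(s i).fst - w.fst‖ + ‖(s i).snd - w.snd‖)) ∧
    ρ ^ j * γbar * (‖(s j).fst - w.fst‖ + ‖(s j).snd - w.snd‖) ≤ μ ∧
    ((merit g (w + α • (s j - w)) < merit g (w + (s j - w)) ∧ w' = w + α • (s j - w)) ∨
      (merit g (w + (s j - w)) ≤ merit g (w + α • (s j - w)) ∧ w' = w + (s j - w)))

/-- `w 0, …, w k` are the first points of a run of CRN-SPP from `w₀` with accuracy `ε`, which has
made `k` iterations: an iteration is made only from a point with merit larger than `ε`. -/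
def IsCRNRun {n m : ℕ} (g : Pt n m → ℝ) (μ γbar ρ α ε : ℝ) (w₀ : Pt n m) (k : ℕ)
    (w : ℕ → Pt n m) : Prop :=
  w 0 = w₀ ∧ ∀ j < k, ε < merit g (w j) ∧ CRNStep g μ γbar ρ α (w j) (w (j + 1))

end

end TensorSPP

/-!
The saddle operator `F` of a `μ`-strongly convex-concave function is `μ`-strongly monotone, and it
is `L₁`-Lipschitz, so it has exactly one zero `z*`, which is the unique saddle point
(`exists_isSaddlePoint`). Both phases are measured against `z*`.

*Restarts.* One iteration of HighOrderMirrorProx satisfies an energy estimate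
(`MirrorProxStep.energy_le`): the bounds on the step size absorb the Taylor error of `F`, and what
is left bounds `μ ∑ γ t ‖zh t - z*‖²` and `∑ ‖zh t - z t‖²` by multiples of `R²`. The second bound
keeps the lengths `‖zh t - z t‖` small, hence the step sizes large: by convexity
`∑ γ t ≥ 2 / μ` for the prescribed number of iterations (`two_div_le_sum_stepSize`). Jensen's
inequality then shows that the averaged point is at distance at most `R / 2` from `z*`
(`MirrorProxOutput.norm_sub_le_half`). The summand `1` in the number of restarts gives a final
distance of at most `μ / (2 L₂ ξ)`, half of what is claimed, so that `‖F‖ ≤ μ² / (2 L₂)` there.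

*CRN-SPP.* The first-order condition of the cubic subproblem at `w` is
`F w + ∇F(w) d + γ (‖dx‖ dx, ‖dy‖ dy) = 0`. It is a strongly monotone equation, so it is solvable,
with `‖d‖ ≤ ‖F w‖ / μ`, and its solution is the only saddle point of the model
(`exists_unique_cubicModel_saddle`). As the residual of the linearization is at most `γ ‖d‖²`, one
gets `‖F (w + d)‖ ≤ L₂ (‖F w‖ / μ)²` (`CRNStep.norm_saddleOp_le`); the factor `1 / 2` gained above
turns this into `‖F (w k)‖ ≤ (μ² / L₂) 2^(-2^k)`. In this region the first trial is always accepted,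
and the duality gap is at most `‖F‖² / (2 μ)` (`exists_isDualityGap_le`).

*Counting.* A run of `k ≥ 1` iterations forces `2^k log 2 < log (1 / ε) + C`, with `C` depending on
`μ, L₁, L₂` only. For small `ε` the right-hand side is at most the square of
`2 log (B / ε) / log (L₁ L₂ / μ²)`, so that an absolute constant suffices
(`exists_threshold_iteration_bound`).
-/

/-! ### Strongly monotone operators and smooth functions on Hilbert spaces -/

namespace TensorSPP

section Hilbert

variable {E : Type*} [NormedAddCommGroup E] [InnerProductSpace ℝ E]

/-- Since `z ↦ z - τ Ψ z` is a contraction for `τ = μ / M²` and every `M ≥ max L μ`, the operator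
`Ψ` has a zero. -/
theorem exists_eq_zero_of_stronglyMonotone [CompleteSpace E] {Ψ : E → E} {μ L : ℝ} (hμ : 0 < μ)
    (hmono : ∀ a b, μ * ‖a - b‖ ^ 2 ≤ inner ℝ (Ψ a - Ψ b) (a - b))
    (hL : ∀ a b, ‖Ψ a - Ψ b‖ ≤ L * ‖a - b‖) : ∃ z, Ψ z = 0 := by
  set M : ℝ := |L| + μ with hM
  have hMpos : 0 < M := by positivity
  have hLM : ∀ a b, ‖Ψ a - Ψ b‖ ≤ M * ‖a - b‖ := fun a b =>
    (hL a b).trans (mul_le_mul_of_nonneg_right (by linarith [le_abs_self L]) (norm_nonneg _))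
  set τ : ℝ := μ / M ^ 2 with hτ
  have hτpos : 0 < τ := by positivity
  set q : ℝ := 1 - μ ^ 2 / M ^ 2 with hq
  have hq1 : q < 1 := by
    have : 0 < μ ^ 2 / M ^ 2 := by positivity
    linarith
  have hq0 : 0 ≤ q := by
    have : μ ^ 2 / M ^ 2 ≤ 1 := by
      rw [div_le_one (by positivity)]
      gcongr
      linarith [abs_nonneg L]
    linarith
  have key : ∀ a b, ‖(a - τ • Ψ a) - (b - τ • Ψ b)‖ ≤ √q * ‖a - b‖ := by
    intro a b
    have e : (a - τ • Ψ a) - (b - τ • Ψ b) = (a - b) - τ • (Ψ a - Ψ b) := by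
      rw [smul_sub]; abel
    have h1 : ‖(a - b) - τ • (Ψ a - Ψ b)‖ ^ 2 ≤ q * ‖a - b‖ ^ 2 := by
      rw [norm_sub_sq_real, inner_smul_right, norm_smul, mul_pow, Real.norm_eq_abs, sq_abs,
        real_inner_comm]
      have h2 := hmono a b
      have h3 : ‖Ψ a - Ψ b‖ ^ 2 ≤ M ^ 2 * ‖a - b‖ ^ 2 := by
        rw [← mul_pow]; exact pow_le_pow_left₀ (norm_nonneg _) (hLM a b) 2
      have h4 : τ ^ 2 * ‖Ψ a - Ψ b‖ ^ 2 ≤ τ ^ 2 * (M ^ 2 * ‖a - b‖ ^ 2) := by gcongr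
      have h5 : τ * (μ * ‖a - b‖ ^ 2) ≤ τ * inner ℝ (Ψ a - Ψ b) (a - b) := by gcongr
      have h6 : q * ‖a - b‖ ^ 2 = ‖a - b‖ ^ 2 - 2 * (τ * (μ * ‖a - b‖ ^ 2))
          + τ ^ 2 * (M ^ 2 * ‖a - b‖ ^ 2) := by
        rw [hq, hτ]; field_simp; ring
      linarith
    rw [e]
    calc _ = √(‖(a - b) - τ • (Ψ a - Ψ b)‖ ^ 2) := (Real.sqrt_sq (norm_nonneg _)).symm
      _ ≤ √(q * ‖a - b‖ ^ 2) := Real.sqrt_le_sqrt h1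
      _ = _ := by rw [Real.sqrt_mul hq0, Real.sqrt_sq (norm_nonneg _)]
  have hc : ContractingWith (√q).toNNReal (fun a => a - τ • Ψ a) := by
    refine ⟨?_, LipschitzWith.of_dist_le_mul fun a b => ?_⟩
    · rw [← Real.toNNReal_one, Real.toNNReal_lt_toNNReal_iff one_pos, Real.sqrt_lt' one_pos]
      simpa using hq1
    · rw [dist_eq_norm, dist_eq_norm, Real.coe_toNNReal _ (Real.sqrt_nonneg _)]
      exact key a b
  refine ⟨hc.fixedPoint, ?_⟩
  have h := hc.fixedPoint_isFixedPt
  have h' : τ • Ψ hc.fixedPoint = 0 := by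
    have h2 : hc.fixedPoint - τ • Ψ hc.fixedPoint = hc.fixedPoint := h
    simpa using h2
  exact (smul_eq_zero.1 h').resolve_left hτpos.ne'

/-- A zero of a `μ`-strongly monotone operator is at distance at most `‖Ψ 0‖ / μ` from `0`. -/
theorem norm_le_div_of_stronglyMonotone {Ψ : E → E} {μ : ℝ} (hμ : 0 < μ) {a : E}
    (h : μ * ‖a‖ ^ 2 ≤ inner ℝ (Ψ a - Ψ 0) a) (ha : Ψ a = 0) : ‖a‖ ≤ ‖Ψ 0‖ / μ := by
  rw [le_div_iff₀ hμ]
  have h1 : inner ℝ (Ψ a - Ψ 0) a ≤ ‖Ψ 0‖ * ‖a‖ := by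
    rw [ha, zero_sub]
    simpa using real_inner_le_norm (-Ψ 0) a
  rcases (norm_nonneg a).eq_or_lt with h0 | h0
  · rw [← h0]; simp
  · refine le_of_mul_le_mul_right ?_ h0
    nlinarith

theorem add_inner_add_le_of_monotone_gradient [CompleteSpace E] {f : E → ℝ} {G : E → E} {μ : ℝ}
    (hf : ∀ a, HasGradientAt f (G a) a)
    (hmono : ∀ a b, μ * ‖a - b‖ ^ 2 ≤ inner ℝ (G a - G b) (a - b)) (a b : E) :
    f a + inner ℝ (G a) (b - a) + μ / 2 * ‖b - a‖ ^ 2 ≤ f b := by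
  set u := b - a with hu
  let φ : ℝ → ℝ := fun t => f (a + t • u) - t * inner ℝ (G a) u - μ / 2 * t ^ 2 * ‖u‖ ^ 2
  have hφ : ∀ t, HasDerivAt φ (inner ℝ (G (a + t • u)) u - inner ℝ (G a) u - μ * t * ‖u‖ ^ 2) t := by
    intro t
    have h1 : HasDerivAt (fun t : ℝ => a + t • u) u t := by
      simpa using ((hasDerivAt_id t).smul_const u).const_add a
    have h2 : HasDerivAt (fun t : ℝ => f (a + t • u)) (inner ℝ (G (a + t • u)) u) t := by
      refine ((hf (a + t • u)).hasFDerivAt.comp_hasDerivAt t h1).congr_deriv ?_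
      simp
    have h3 := ((hasDerivAt_id t).mul_const (inner ℝ (G a) u))
    have h4 := ((hasDerivAt_pow 2 t).const_mul (μ / 2)).mul_const (‖u‖ ^ 2)
    refine ((h2.sub h3).sub h4).congr_deriv ?_
    push_cast
    ring
  have hm : MonotoneOn φ (Set.Icc 0 1) := by
    refine monotoneOn_of_deriv_nonneg (convex_Icc 0 1)
      (fun t _ => (hφ t).continuousAt.continuousWithinAt)
      (fun t _ => (hφ t).differentiableAt.differentiableWithinAt) fun t ht => ?_
    rw [interior_Icc] at ht
    rw [(hφ t).deriv]
    have h := hmono (a + t • u) a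
    rw [add_sub_cancel_left, norm_smul, inner_smul_right, Real.norm_eq_abs, mul_pow, sq_abs,
      inner_sub_left] at h
    have h2 : t * (μ * t * ‖u‖ ^ 2) ≤ t * (inner ℝ (G (a + t • u)) u - inner ℝ (G a) u) := by
      nlinarith
    linarith [le_of_mul_le_mul_left h2 ht.1]
  have := hm (Set.left_mem_Icc.2 zero_le_one) (Set.right_mem_Icc.2 zero_le_one) zero_le_one
  simp only [φ, zero_smul, one_smul, add_zero] at this
  have hb : a + u = b := by simp [hu]
  rw [hb] at this
  linarith

/-- The proximal step in closed form. -/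
theorem eq_sub_of_isMinOn_inner_add_sq {a c z zh : E}
    (h : IsMinOn (fun u => inner ℝ a (u - c) + (1 / 2) * ‖u - z‖ ^ 2) Set.univ zh) :
    zh = z - a := by
  have key : ∀ u : E, inner ℝ a (u - c) + (1 / 2) * ‖u - z‖ ^ 2 =
      inner ℝ a (z - c) - 1 / 2 * ‖a‖ ^ 2 + 1 / 2 * ‖u - (z - a)‖ ^ 2 := by
    intro u
    have e1 : u - (z - a) = (u - z) + a := by abel
    have e2 : u - c = (u - z) + (z - c) := by abel
    rw [e1, e2, norm_add_sq_real, inner_add_right, real_inner_comm a (u - z)]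
    ring
  have h1 := isMinOn_univ_iff.1 h (z - a)
  rw [key, key] at h1
  simp only [sub_self, norm_zero] at h1
  have h2 : ‖zh - (z - a)‖ ^ 2 ≤ 0 := by linarith
  exact sub_eq_zero.1 (norm_eq_zero.1 (pow_eq_zero_iff two_ne_zero |>.1
    (le_antisymm h2 (by positivity))))

theorem inner_fderiv_ge_of_stronglyMonotone {F : E → E} {μ : ℝ}
    (hmono : ∀ a b, μ * ‖a - b‖ ^ 2 ≤ inner ℝ (F a - F b) (a - b)) {z : E}
    (hF : DifferentiableAt ℝ F z) (d : E) : μ * ‖d‖ ^ 2 ≤ inner ℝ (fderiv ℝ F z d) d := by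
  have h1 : HasDerivAt (fun t : ℝ => z + t • d) d 0 := by
    simpa using ((hasDerivAt_id (0 : ℝ)).smul_const d).const_add z
  have h2 : HasDerivAt (fun t : ℝ => F (z + t • d)) (fderiv ℝ F z d) 0 := by
    have h3 : HasFDerivAt F (fderiv ℝ F z) (z + (0 : ℝ) • d) := by simpa using hF.hasFDerivAt
    exact h3.comp_hasDerivAt (0 : ℝ) h1
  have h4 := (hasDerivAt_iff_tendsto_slope_zero.1 h2).inner (𝕜 := ℝ)
    (tendsto_const_nhds (x := d))
  refine ge_of_tendsto h4 (eventually_nhdsWithin_of_forall fun t ht => ?_)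
  have ht' : t ≠ 0 := ht
  have h5 := hmono (z + t • d) z
  rw [add_sub_cancel_left, norm_smul, inner_smul_right, Real.norm_eq_abs, mul_pow, sq_abs] at h5
  simp only [zero_add, zero_smul, add_zero, inner_smul_left, conj_trivial]
  have h6 : t⁻¹ * inner ℝ (F (z + t • d) - F z) d
      = (t ^ 2)⁻¹ * (t * inner ℝ (F (z + t • d) - F z) d) := by field_simp
  rw [h6, inv_mul_eq_div, le_div_iff₀ (by positivity)]
  linarith

end Hilbert

section Taylor

variable {E V : Type*} [NormedAddCommGroup E] [NormedSpace ℝ E]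
  [NormedAddCommGroup V] [NormedSpace ℝ V]

open Finset in
/-- Taylor's formula on `[0, 1]` for a function `f 0` with successive derivatives `f 1, …, f q`,
of which only the last is controlled, by a Lipschitz condition at `0`. -/
theorem norm_sub_taylor_le_of_lipschitz (M : ℝ) (q : ℕ) : ∀ f : ℕ → ℝ → V,
    (∀ k < q, ∀ t, HasDerivAt (f k) (f (k + 1) t) t) →
    (∀ t ∈ Set.Icc (0 : ℝ) 1, ‖f q t - f q 0‖ ≤ M * t) →
    ∀ t ∈ Set.Icc (0 : ℝ) 1,
      ‖f 0 t - ∑ i ∈ range (q + 1), (t ^ i / (i.factorial : ℝ)) • f i 0‖ ≤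
        M * (t ^ (q + 1) / ((q + 1).factorial : ℝ)) := by
  induction q with
  | zero => intro f _ h t ht; simpa using h t ht
  | succ q ih =>
    intro f hd h
    have ih' := ih (fun k => f (k + 1)) (fun k hk t => hd (k + 1) (by omega) t) h
    have hpow : ∀ (i : ℕ) (t : ℝ), HasDerivAt
        (fun t : ℝ => t ^ (i + 1) / ((i + 1).factorial : ℝ)) (t ^ i / (i.factorial : ℝ)) t := by
      intro i t
      refine ((hasDerivAt_pow (i + 1) t).div_const _).congr_deriv ?_
      rw [Nat.factorial_succ]
      have : (i.factorial : ℝ) ≠ 0 := by positivity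
      push_cast
      field_simp
    have hderiv : ∀ t, HasDerivAt
        (fun t => f 0 t - ∑ i ∈ range (q + 2), (t ^ i / (i.factorial : ℝ)) • f i 0)
        (f 1 t - ∑ i ∈ range (q + 1), (t ^ i / (i.factorial : ℝ)) • f (i + 1) 0) t := by
      intro t
      simp_rw [sum_range_succ' _ (q + 1)]
      refine (hd 0 (by omega) t).sub ?_
      have h2 : HasDerivAt (fun t : ℝ => ∑ i ∈ range (q + 1),
          (t ^ (i + 1) / ((i + 1).factorial : ℝ)) • f (i + 1) 0)
          (∑ i ∈ range (q + 1), (t ^ i / (i.factorial : ℝ)) • f (i + 1) 0) t :=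
        HasDerivAt.fun_sum fun i _ => (hpow i t).smul_const _
      simpa using h2.add_const (f 0 0)
    refine image_norm_le_of_norm_deriv_right_le_deriv_boundary
      (fun t _ => (hderiv t).continuousAt.continuousWithinAt)
      (fun t _ => (hderiv t).hasDerivWithinAt) ?_ (fun t => (hpow (q + 1) t).const_mul M)
      (fun t ht => ih' t (Set.Ico_subset_Icc_self ht))
    rw [sum_range_succ']
    simp

theorem norm_sub_taylorApprox_le {F : E → V} {q : ℕ} (hF : ContDiff ℝ q F) {M : ℝ}
    (hM : ∀ z₁ z₂, ‖iteratedFDeriv ℝ q F z₁ - iteratedFDeriv ℝ q F z₂‖ ≤ M * ‖z₁ - z₂‖) (z w : E) :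
    ‖F w - taylorApprox F q z w‖ ≤ M / ((q + 1).factorial : ℝ) * ‖w - z‖ ^ (q + 1) := by
  set d := w - z with hd
  have hline : ∀ t : ℝ, HasDerivAt (fun t : ℝ => z + t • d) d t := fun t => by
    simpa using ((hasDerivAt_id t).smul_const d).const_add z
  have h := norm_sub_taylor_le_of_lipschitz (M * ‖d‖ ^ (q + 1)) q
    (fun k t => iteratedFDeriv ℝ k F (z + t • d) fun _ => d) ?_ ?_ 1 (by simp)
  · simp only [one_smul, zero_smul, add_zero, one_pow, iteratedFDeriv_zero_apply] at h
    have hw : z + d = w := by simp [hd]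
    rw [hw] at h
    refine h.trans_eq ?_
    ring
  · intro k hk t
    have h1 : DifferentiableAt ℝ (iteratedFDeriv ℝ k F) (z + t • d) :=
      (hF.differentiable_iteratedFDeriv (by exact_mod_cast hk)).differentiableAt
    have h2 := h1.hasFDerivAt.comp_hasDerivAt t (hline t)
    have h3 := ((ContinuousMultilinearMap.apply ℝ (fun _ : Fin k => E) V
      (fun _ => d)).hasFDerivAt).comp_hasDerivAt t h2
    refine h3.congr_deriv ?_
    simp only [iteratedFDeriv_succ_apply_left]
    rfl
  · intro t ht
    simp only [zero_smul, add_zero]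
    rw [← sub_apply]
    refine (ContinuousMultilinearMap.le_opNorm _ _).trans ?_
    rw [Finset.prod_const, Finset.card_univ, Fintype.card_fin]
    have h1 := hM (z + t • d) z
    rw [add_sub_cancel_left, norm_smul, Real.norm_eq_abs, abs_of_nonneg ht.1] at h1
    calc _ ≤ (M * (t * ‖d‖)) * ‖d‖ ^ q := by gcongr
      _ = _ := by ring

end Taylor

end TensorSPP

/-! ### Calculus of the saddle operator -/

namespace TensorSPP

variable {n m : ℕ}

/-- The reflection `(x, y) ↦ (x, -y)`. -/
noncomputable def reflectY (n m : ℕ) : Pt n m →L[ℝ] Pt n m :=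
  ((WithLp.prodContinuousLinearEquiv 2 ℝ (Vec n) (Vec m)).symm : Vec n × Vec m →L[ℝ] Pt n m).comp
    ((WithLp.fstL 2 ℝ (Vec n) (Vec m)).prod (-WithLp.sndL 2 ℝ (Vec n) (Vec m)))

theorem reflectY_apply (z : Pt n m) : reflectY n m z = pt z.fst (-z.snd) := rfl

/-- The embedding `x ↦ (x, 0)`. -/
noncomputable def embX (n m : ℕ) : Vec n →L[ℝ] Pt n m :=
  ((WithLp.prodContinuousLinearEquiv 2 ℝ (Vec n) (Vec m)).symm : Vec n × Vec m →L[ℝ] Pt n m).comp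
    (ContinuousLinearMap.inl ℝ (Vec n) (Vec m))

/-- The embedding `y ↦ (0, y)`. -/
noncomputable def embY (n m : ℕ) : Vec m →L[ℝ] Pt n m :=
  ((WithLp.prodContinuousLinearEquiv 2 ℝ (Vec n) (Vec m)).symm : Vec n × Vec m →L[ℝ] Pt n m).comp
    (ContinuousLinearMap.inr ℝ (Vec n) (Vec m))

theorem embX_apply (x : Vec n) : embX n m x = pt x 0 := rfl

theorem embY_apply (y : Vec m) : embY n m y = pt 0 y := rfl

theorem inner_pt_left (x : Vec n) (y : Vec m) (z : Pt n m) :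
    inner ℝ (pt x y) z = inner ℝ x z.fst + inner ℝ y z.snd :=
  WithLp.prod_inner_apply _ _

theorem pt_ext {z w : Pt n m} (h₁ : z.fst = w.fst) (h₂ : z.snd = w.snd) : z = w := by
  rw [← WithLp.toLp_ofLp (p := 2) z, ← WithLp.toLp_ofLp (p := 2) w]
  exact congrArg _ (Prod.ext h₁ h₂)

section Derivatives

variable {g : Pt n m → ℝ}

theorem hasFDerivAt_pt_left (x : Vec n) (y : Vec m) :
    HasFDerivAt (fun x : Vec n => pt x y) (embX n m) x := by
  have h : (fun x : Vec n => pt x y) = fun x => embX n m x + pt 0 y := by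
    funext x; exact pt_ext (by simp [embX_apply]) (by simp [embX_apply])
  rw [h]
  exact (embX n m).hasFDerivAt.add_const _

theorem hasFDerivAt_pt_right (x : Vec n) (y : Vec m) :
    HasFDerivAt (fun y : Vec m => pt x y) (embY n m) y := by
  have h : (fun y : Vec m => pt x y) = fun y => embY n m y + pt x 0 := by
    funext x; exact pt_ext (by simp [embY_apply]) (by simp [embY_apply])
  rw [h]
  exact (embY n m).hasFDerivAt.add_const _

theorem hasGradientAt_left (hg : Differentiable ℝ g) (x : Vec n) (y : Vec m) :
    HasGradientAt (fun x => g (pt x y)) (gradX g (pt x y)) x :=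
  DifferentiableAt.hasGradientAt
    ((hg _).comp x (hasFDerivAt_pt_left x y).differentiableAt)

theorem hasGradientAt_right (hg : Differentiable ℝ g) (x : Vec n) (y : Vec m) :
    HasGradientAt (fun y => g (pt x y)) (gradY g (pt x y)) y :=
  DifferentiableAt.hasGradientAt
    ((hg _).comp y (hasFDerivAt_pt_right x y).differentiableAt)

theorem inner_gradX (hg : Differentiable ℝ g) (z : Pt n m) (u : Vec n) :
    inner ℝ (gradX g z) u = fderiv ℝ g z (pt u 0) := by
  have h1 := (hasGradientAt_left hg z.fst z.snd).hasFDerivAt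
  have h2 := HasFDerivAt.comp z.fst (hg (pt z.fst z.snd)).hasFDerivAt
    (hasFDerivAt_pt_left z.fst z.snd)
  exact DFunLike.congr_fun (h1.unique h2) u

theorem inner_gradY (hg : Differentiable ℝ g) (z : Pt n m) (v : Vec m) :
    inner ℝ (gradY g z) v = fderiv ℝ g z (pt 0 v) := by
  have h1 := (hasGradientAt_right hg z.fst z.snd).hasFDerivAt
  have h2 := HasFDerivAt.comp z.snd (hg (pt z.fst z.snd)).hasFDerivAt
    (hasFDerivAt_pt_right z.fst z.snd)
  exact DFunLike.congr_fun (h1.unique h2) v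

/-- Up to the reflection of `y`, the saddle operator represents the derivative of `g`. -/
theorem inner_saddleOp (hg : Differentiable ℝ g) (z v : Pt n m) :
    inner ℝ (saddleOp g z) v = fderiv ℝ g z (reflectY n m v) := by
  rw [saddleOp, inner_pt_left, inner_gradX hg, inner_neg_left, inner_gradY hg, ← map_neg,
    ← map_add]
  congr 1
  exact pt_ext (by simp [reflectY_apply]) (by simp [reflectY_apply])

theorem saddleOp_eq (hg : Differentiable ℝ g) : saddleOp g =
    fun z => (InnerProductSpace.toDual ℝ (Pt n m)).symm ((fderiv ℝ g z).comp (reflectY n m)) := by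
  funext z
  refine ext_inner_right ℝ fun v => ?_
  rw [inner_saddleOp hg, InnerProductSpace.toDual_symm_apply]
  rfl

theorem contDiff_saddleOp {q : ℕ} (hg : ContDiff ℝ (q + 1 : ℕ) g) :
    ContDiff ℝ q (saddleOp g) := by
  rw [saddleOp_eq (hg.differentiable (by simp))]
  have h : ContDiff ℝ q (fderiv ℝ g) := hg.fderiv_right (by push_cast; exact le_rfl)
  exact (InnerProductSpace.toDual ℝ (Pt n m)).symm.toContinuousLinearEquiv.contDiff.comp
    (h.clm_comp contDiff_const)

theorem inner_fderiv_eq {E : Type*} [NormedAddCommGroup E] [InnerProductSpace ℝ E] {F : E → E}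
    {φ : E → E →L[ℝ] ℝ} {z v a : E} (hF : DifferentiableAt ℝ F z) (hφ : DifferentiableAt ℝ φ z)
    (h : ∀ z, inner ℝ (F z) v = φ z a) (d : E) :
    inner ℝ (fderiv ℝ F z d) v = fderiv ℝ φ z d a := by
  have h1 := (innerSL ℝ v).hasFDerivAt.comp z hF.hasFDerivAt
  have h2 := (ContinuousLinearMap.apply ℝ ℝ a).hasFDerivAt.comp z hφ.hasFDerivAt
  have h3 : (innerSL ℝ v) ∘ F = (ContinuousLinearMap.apply ℝ ℝ a) ∘ φ := by
    funext z
    rw [Function.comp_apply, innerSL_apply_apply, real_inner_comm, h z]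
    rfl
  rw [h3] at h1
  have h4 := DFunLike.congr_fun (h1.unique h2) d
  rw [ContinuousLinearMap.comp_apply, innerSL_apply_apply, real_inner_comm] at h4
  exact h4

theorem inner_fderiv_saddleOp (hg : ContDiff ℝ 2 g) (z d v : Pt n m) :
    inner ℝ (fderiv ℝ (saddleOp g) z d) v = fderiv ℝ (fderiv ℝ g) z d (reflectY n m v) := by
  have hF : DifferentiableAt ℝ (saddleOp g) z :=
    ((contDiff_saddleOp (q := 1) hg).differentiable (by simp)).differentiableAt
  have hd : DifferentiableAt ℝ (fderiv ℝ g) z :=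
    ((hg.fderiv_right (m := 1) (by norm_num)).differentiable (by simp)).differentiableAt
  exact inner_fderiv_eq hF hd (fun z => inner_saddleOp (hg.differentiable (by simp)) z v) d

end Derivatives

/-! ### Saddle points of strongly convex-concave functions -/

section Saddle

variable {g : Pt n m → ℝ} {μ : ℝ}

theorem StronglyConvexConcave.le_left (hμ : StronglyConvexConcave μ g) (hg : Differentiable ℝ g)
    (z : Pt n m) (x' : Vec n) :
    g z + inner ℝ (gradX g z) (x' - z.fst) + μ / 2 * ‖x' - z.fst‖ ^ 2 ≤ g (pt x' z.snd) :=
  add_inner_add_le_of_monotone_gradient (fun x => hasGradientAt_left hg x z.snd)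
    (fun a b => hμ.1 a b z.snd) z.fst x'

theorem StronglyConvexConcave.right_le (hμ : StronglyConvexConcave μ g) (hg : Differentiable ℝ g)
    (z : Pt n m) (y' : Vec m) :
    g (pt z.fst y') ≤ g z + inner ℝ (gradY g z) (y' - z.snd) - μ / 2 * ‖y' - z.snd‖ ^ 2 := by
  have h := add_inner_add_le_of_monotone_gradient (f := fun y => -g (pt z.fst y))
    (G := fun y => -gradY g (pt z.fst y)) (μ := μ)
    (fun y => by
      have h := (hasGradientAt_right hg z.fst y).hasFDerivAt.neg
      rw [hasGradientAt_iff_hasFDerivAt, map_neg]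
      exact h)
    (fun a b => by simpa using hμ.2 z.fst a b) z.snd y'
  rw [inner_neg_left] at h
  have hz : g (pt z.fst z.snd) = g z := rfl
  have hz' : gradY g (pt z.fst z.snd) = gradY g z := rfl
  rw [hz, hz'] at h
  linarith

theorem norm_sq_sub (z w : Pt n m) :
    ‖z - w‖ ^ 2 = ‖z.fst - w.fst‖ ^ 2 + ‖z.snd - w.snd‖ ^ 2 :=
  WithLp.prod_norm_sq_eq_of_L2 _

/-- The sum of the strong convexity and concavity inequalities along the four sides of the rectangle
with opposite corners `z` and `w`. -/
theorem StronglyConvexConcave.stronglyMonotone (hμ : StronglyConvexConcave μ g)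
    (hg : Differentiable ℝ g) (z w : Pt n m) :
    μ * ‖z - w‖ ^ 2 ≤ inner ℝ (saddleOp g z - saddleOp g w) (z - w) := by
  have h1 := hμ.le_left hg z w.fst
  have h2 := hμ.right_le hg w z.snd
  have h3 := hμ.le_left hg w z.fst
  have h4 := hμ.right_le hg z w.snd
  rw [norm_sq_sub, inner_sub_left, saddleOp, saddleOp, inner_pt_left, inner_pt_left,
    WithLp.sub_fst, WithLp.sub_snd, inner_neg_left, inner_neg_left]
  rw [← neg_sub z.fst w.fst, inner_neg_right, norm_neg] at h1
  rw [← neg_sub z.snd w.snd, inner_neg_right, norm_neg] at h4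
  linarith

/-- Quadratic growth is needed at `z` only; two saddle points `z`, `s` are compared through the values
at the corners `(z.fst, s.snd)` and `(s.fst, z.snd)`. -/
theorem isSaddlePoint_and_unique_of_quadratic_growth {h : Pt n m → ℝ} {z : Pt n m} (hμ : 0 < μ)
    (hx : ∀ x', h z + μ / 2 * ‖x' - z.fst‖ ^ 2 ≤ h (pt x' z.snd))
    (hy : ∀ y', h (pt z.fst y') ≤ h z - μ / 2 * ‖y' - z.snd‖ ^ 2) :
    IsSaddlePoint h z ∧ ∀ s, IsSaddlePoint h s → s = z := by
  have hnn : ∀ {k : ℕ} (v : Vec k), 0 ≤ μ / 2 * ‖v‖ ^ 2 := fun v => by positivity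
  refine ⟨⟨fun y' => (hy y').trans (sub_le_self _ (hnn _)),
    fun x' => (le_add_of_nonneg_right (hnn _)).trans (hx x')⟩, fun s hs => ?_⟩
  have h1 := hs.2 z.fst
  have h2 := hs.1 z.snd
  have h3 := hx s.fst
  have h4 := hy s.snd
  have h5 : μ / 2 * ‖s - z‖ ^ 2 ≤ μ / 2 * 0 := by rw [norm_sq_sub]; linarith
  have h6 := le_of_mul_le_mul_left h5 (by positivity)
  exact sub_eq_zero.1 (norm_eq_zero.1 (pow_eq_zero_iff two_ne_zero |>.1
    (le_antisymm h6 (by positivity))))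

theorem OrderLipschitz.norm_sub_le {L : ℝ} {F : Pt n m → Pt n m} (h : OrderLipschitz 1 L F)
    (z w : Pt n m) : ‖F z - F w‖ ≤ L * ‖z - w‖ := by
  have h₀ : ‖iteratedFDeriv ℝ 0 F z - iteratedFDeriv ℝ 0 F w‖ ≤ L * ‖z - w‖ := h z w
  simpa only [iteratedFDeriv_zero_eq_comp, Function.comp_apply, ← map_sub,
    LinearIsometryEquiv.norm_map] using h₀

theorem exists_isSaddlePoint {L : ℝ} (hpos : 0 < μ) (hμ : StronglyConvexConcave μ g)
    (hg : Differentiable ℝ g) (hL : OrderLipschitz 1 L (saddleOp g)) :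
    ∃ zs, saddleOp g zs = 0 ∧ IsSaddlePoint g zs ∧ ∀ s, IsSaddlePoint g s → s = zs := by
  obtain ⟨zs, hzs⟩ := exists_eq_zero_of_stronglyMonotone hpos (hμ.stronglyMonotone hg)
    hL.norm_sub_le
  have hX : gradX g zs = 0 := congrArg WithLp.fst hzs
  have hY : gradY g zs = 0 := neg_eq_zero.1 (congrArg WithLp.snd hzs)
  refine ⟨zs, hzs, isSaddlePoint_and_unique_of_quadratic_growth hpos (fun x' => ?_) fun y' => ?_⟩
  · simpa [hX] using hμ.le_left hg zs x'
  · simpa [hY] using hμ.right_le hg zs y'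

theorem norm_fst_le (z : Pt n m) : ‖z.fst‖ ≤ ‖z‖ := by
  refine le_of_sq_le_sq ?_ (norm_nonneg _)
  rw [WithLp.prod_norm_sq_eq_of_L2]
  linarith [sq_nonneg ‖z.snd‖]

theorem norm_snd_le (z : Pt n m) : ‖z.snd‖ ≤ ‖z‖ := by
  refine le_of_sq_le_sq ?_ (norm_nonneg _)
  rw [WithLp.prod_norm_sq_eq_of_L2]
  linarith [sq_nonneg ‖z.fst‖]

theorem norm_pt_sub_left (x x' : Vec n) (y : Vec m) : ‖pt x y - pt x' y‖ = ‖x - x'‖ := by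
  refine (sq_eq_sq₀ (norm_nonneg _) (norm_nonneg _)).1 ?_
  simp [norm_sq_sub]

theorem norm_pt_sub_right (x : Vec n) (y y' : Vec m) : ‖pt x y - pt x y'‖ = ‖y - y'‖ := by
  refine (sq_eq_sq₀ (norm_nonneg _) (norm_nonneg _)).1 ?_
  simp [norm_sq_sub]

/-- Maximising `⟨v, u⟩ - μ/2 ‖u‖²` over `u`. -/
theorem inner_sub_sq_le {k : ℕ} (hpos : 0 < μ) (v u : Vec k) :
    inner ℝ v u - μ / 2 * ‖u‖ ^ 2 ≤ ‖v‖ ^ 2 / (2 * μ) := by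
  have h := real_inner_le_norm v u
  rw [le_div_iff₀ (by positivity)]
  nlinarith [sq_nonneg (‖v‖ - μ * ‖u‖)]

/-- Each of the two parts of the gap is at most the squared partial gradient divided by `2 μ`. -/
theorem exists_isDualityGap_le {L : ℝ} (hpos : 0 < μ) (hμ : StronglyConvexConcave μ g)
    (hg : Differentiable ℝ g) (hL : OrderLipschitz 1 L (saddleOp g)) (z : Pt n m) :
    ∃ G, IsDualityGap g z G ∧ G ≤ merit g z / μ := by
  obtain ⟨x₀, hx₀⟩ := exists_eq_zero_of_stronglyMonotone (Ψ := fun x => gradX g (pt x z.snd)) hpos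
    (fun a b => hμ.1 a b z.snd) (L := L) fun a b => by
      rw [← norm_pt_sub_left a b z.snd]
      exact (norm_fst_le (saddleOp g (pt a z.snd) - saddleOp g (pt b z.snd))).trans
        (hL.norm_sub_le _ _)
  obtain ⟨y₀, hy₀⟩ := exists_eq_zero_of_stronglyMonotone (Ψ := fun y => -gradY g (pt z.fst y)) hpos
    (fun a b => by simpa using hμ.2 z.fst a b) (L := L) fun a b => by
      rw [← norm_pt_sub_right z.fst a b]
      exact (norm_snd_le (saddleOp g (pt z.fst a) - saddleOp g (pt z.fst b))).trans
        (hL.norm_sub_le _ _)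
  rw [neg_eq_zero] at hy₀
  refine ⟨_, ⟨g (pt z.fst y₀), g (pt x₀ z.snd), ⟨⟨y₀, rfl⟩, ?_⟩, ⟨⟨x₀, rfl⟩, ?_⟩, rfl⟩, ?_⟩
  · rintro _ ⟨y', rfl⟩
    have h := hμ.right_le hg (pt z.fst y₀) y'
    rw [hy₀, inner_zero_left] at h
    have : 0 ≤ μ / 2 * ‖y' - y₀‖ ^ 2 := by positivity
    simp only [WithLp.toLp_fst, WithLp.toLp_snd] at h ⊢
    linarith
  · rintro _ ⟨x', rfl⟩
    have h := hμ.le_left hg (pt x₀ z.snd) x'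
    rw [hx₀, inner_zero_left] at h
    have : 0 ≤ μ / 2 * ‖x' - x₀‖ ^ 2 := by positivity
    simp only [WithLp.toLp_fst, WithLp.toLp_snd] at h ⊢
    linarith
  · have h1 := hμ.le_left hg z x₀
    have h2 := hμ.right_le hg z y₀
    have h3 := inner_sub_sq_le hpos (gradY g z) (y₀ - z.snd)
    have h4 := inner_sub_sq_le hpos (-gradX g z) (x₀ - z.fst)
    rw [inner_neg_left, norm_neg] at h4
    have h5 : merit g z / μ = ‖gradX g z‖ ^ 2 / (2 * μ) + ‖gradY g z‖ ^ 2 / (2 * μ) := by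
      rw [merit, WithLp.prod_norm_sq_eq_of_L2]
      simp only [saddleOp, WithLp.toLp_fst, WithLp.toLp_snd, norm_neg]
      field_simp
    linarith

end Saddle

end TensorSPP

/-! ### HighOrderMirrorProx halves the distance to the solution -/

namespace TensorSPP

open Finset

variable {n m : ℕ}

section MirrorProx

variable {F : Pt n m → Pt n m} {μ Lp : ℝ}

theorem eq_of_stronglyMonotone_of_eq_zero {E : Type*} [NormedAddCommGroup E]
    [InnerProductSpace ℝ E] {F : E → E} {μ : ℝ} (hμ : 0 < μ)
    (hmono : ∀ z w, μ * ‖z - w‖ ^ 2 ≤ inner ℝ (F z - F w) (z - w)) {z w : E}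
    (hz : F z = 0) (hw : F w = 0) : z = w := by
  have h := hmono z w
  rw [hz, hw, sub_zero, inner_zero_left] at h
  have h2 : ‖z - w‖ ^ 2 ≤ 0 := nonpos_of_mul_nonpos_right h hμ
  exact sub_eq_zero.1 (norm_eq_zero.1 (pow_eq_zero_iff two_ne_zero |>.1
    (le_antisymm h2 (by positivity))))

theorem MirrorProxStep.pos {p : ℕ} (hLp : 0 < Lp) {z zh z' : Pt n m} {γ : ℝ}
    (h : MirrorProxStep F p Lp z γ zh z') : 0 < γ := by
  have h1 : 0 < γ * (Lp * ‖zh - z‖ ^ (p - 1)) := lt_of_lt_of_le (by positivity) h.2.1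
  exact pos_of_mul_pos_left h1 (by positivity)

/-- The energy estimate of one iteration: the upper bound for `γ` makes the error of the Taylor
approximation at most `‖zh - z‖ / 16`, so that a positive multiple of `‖zh - z‖²` is left over. -/
theorem MirrorProxStep.energy_le {q : ℕ} (hLp : 0 < Lp)
    (hmono : ∀ z w, μ * ‖z - w‖ ^ 2 ≤ inner ℝ (F z - F w) (z - w))
    (hF : ContDiff ℝ q F) (hLip : OrderLipschitz (q + 1) Lp F) {zs : Pt n m} (hzs : F zs = 0)
    {z zh z' : Pt n m} {γ : ℝ} (h : MirrorProxStep F (q + 1) Lp z γ zh z') :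
    μ * (γ * ‖zh - zs‖ ^ 2) + 1 / 4 * ‖zh - z‖ ^ 2 ≤
      1 / 2 * ‖z - zs‖ ^ 2 - 1 / 2 * ‖z' - zs‖ ^ 2 := by
  have hγ := h.pos hLp
  obtain ⟨h1, -, h3, h4⟩ := h
  simp only [Nat.add_sub_cancel] at h1 h3
  have e1 : zh = z - γ • taylorApprox F q z zh := by
    refine eq_sub_of_isMinOn_inner_add_sq (c := z) ?_
    simpa only [real_inner_smul_left, bregman] using h1
  have e2 : z' = z - γ • F zh := eq_sub_of_isMinOn_inner_add_sq (c := zh) h4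
  have hT := norm_sub_taylorApprox_le hF (M := Lp) hLip z zh
  set r := ‖zh - z‖ with hr
  have hr0 : 0 ≤ r := norm_nonneg _
  set A := γ • F zh with hA
  have hC : z - zh = γ • taylorApprox F q z zh := by
    nth_rewrite 1 [e1]; abel
  have hCr : ‖z - zh‖ = r := norm_sub_rev _ _
  have hAC : ‖A - (z - zh)‖ ≤ r / 16 := by
    rw [hC, hA, ← smul_sub, norm_smul, Real.norm_eq_abs, abs_of_pos hγ]
    have hfac : (0 : ℝ) < ((q + 1).factorial : ℝ) := by positivity
    calc γ * ‖F zh - taylorApprox F q z zh‖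
        ≤ γ * (Lp / ((q + 1).factorial : ℝ) * r ^ (q + 1)) := by gcongr
      _ = γ * (Lp * r ^ q) * (r / ((q + 1).factorial : ℝ)) := by ring
      _ ≤ ((q + 1).factorial : ℝ) / 16 * (r / ((q + 1).factorial : ℝ)) := by gcongr
      _ = r / 16 := by field_simp
  have hAC2 : ‖A - (z - zh)‖ ^ 2 ≤ (r / 16) ^ 2 := pow_le_pow_left₀ (norm_nonneg _) hAC 2
  have hm : μ * (γ * ‖zh - zs‖ ^ 2) ≤ inner ℝ A (zh - zs) := by
    have := mul_le_mul_of_nonneg_left (hmono zh zs) hγ.le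
    rw [hzs, sub_zero] at this
    rw [hA, real_inner_smul_left]
    linarith
  -- the three-point identity
  have hid : inner ℝ A (zh - zs) = 1 / 2 * ‖z - zs‖ ^ 2 - 1 / 2 * ‖z' - zs‖ ^ 2
      - 1 / 2 * ‖z - zh‖ ^ 2 + 1 / 2 * ‖A - (z - zh)‖ ^ 2 := by
    have e3 : z' - zs = (z - zs) - A := by rw [e2]; abel
    have e4 : zh - zs = (z - zs) - (z - zh) := by abel
    rw [e3, e4, norm_sub_sq_real (z - zs) A, norm_sub_sq_real A, inner_sub_right,
      real_inner_comm A (z - zs)]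
    ring
  rw [hCr] at hid
  nlinarith

/-- From `x^(-q) = exp (-q log x)` and `2 log x ≤ x² - 1`. -/
theorem one_sub_mul_sq_sub_one_le_inv_pow {q : ℕ} {x : ℝ} (hx : 0 ≤ x) (h : x ^ q ≠ 0) :
    1 - (q : ℝ) / 2 * (x ^ 2 - 1) ≤ (x ^ q)⁻¹ := by
  rcases hx.eq_or_lt with rfl | hx
  · have : q = 0 := by
      by_contra hq
      exact h (zero_pow hq)
    subst this
    simp
  · have h1 : (x ^ q)⁻¹ = Real.exp (-(q * Real.log x)) := by
      rw [Real.exp_neg, mul_comm, Real.exp_mul, Real.exp_log hx, Real.rpow_natCast]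
    have h2 := Real.add_one_le_exp (-(q * Real.log x))
    have h3 := Real.log_le_sub_one_of_pos (x := x ^ 2) (by positivity)
    rw [Real.log_pow] at h3
    push_cast at h3
    rw [h1]
    have : (q : ℝ) * (2 * Real.log x) ≤ q * (x ^ 2 - 1) := by gcongr
    linarith

theorem two_pow_le_factorial_succ (q : ℕ) : 2 ^ q ≤ (q + 1).factorial := by
  induction q with
  | zero => simp
  | succ q ih =>
    rw [pow_succ, Nat.factorial_succ]
    nlinarith

/-- The step sizes add up to at least `2 / μ`: by convexity of `r ↦ r^(-q)` the sum is smallest when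
all lengths `r t` are equal. The scale `b` exceeds this common length by the factor `√2`, for
which `p! ≥ 2^(p-1)` makes up. -/
theorem two_div_le_sum_stepSize {q T : ℕ} (hμ : 0 < μ) (hLp : 0 < Lp) {R : ℝ} (hR : 0 < R)
    (hT : (64 * Lp * R ^ q / μ) ^ (2 / (((q + 1 : ℕ) : ℝ) + 1)) ≤ T) {r γ : ℕ → ℝ}
    (hr : ∀ t < T, 0 ≤ r t)
    (hγ : ∀ t < T, ((q + 1).factorial : ℝ) / 32 ≤ γ t * (Lp * r t ^ q))
    (hsum : ∑ t ∈ range T, r t ^ 2 ≤ 2 * R ^ 2) : 2 / μ ≤ ∑ t ∈ range T, γ t := by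
  set A : ℝ := 64 * Lp * R ^ q / μ with hA
  have hApos : 0 < A := by positivity
  have hTpos : (0 : ℝ) < T := lt_of_lt_of_le (Real.rpow_pos_of_pos hApos _) hT
  have hAT : A ≤ √(T : ℝ) ^ (q + 2) := by
    refine le_of_sq_le_sq ?_ (by positivity)
    rw [← pow_mul, mul_comm (q + 2) 2, pow_mul, Real.sq_sqrt hTpos.le]
    calc A ^ 2 = (A ^ (2 / (((q + 1 : ℕ) : ℝ) + 1))) ^ (q + 2) := by
          rw [← Real.rpow_natCast (A ^ _), ← Real.rpow_mul hApos.le, ← Real.rpow_natCast A 2]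
          congr 1
          push_cast
          field_simp
          ring
      _ ≤ (T : ℝ) ^ (q + 2) := pow_le_pow_left₀ (by positivity) hT _
  set f : ℝ := ((q + 1).factorial : ℝ) with hf
  have hf2 : (2 : ℝ) ^ q ≤ f := by rw [hf]; exact_mod_cast two_pow_le_factorial_succ q
  have hfpos : 0 < f := by positivity
  set b : ℝ := 2 * R / √(T : ℝ) with hb
  have hbpos : 0 < b := by positivity
  have hb2 : b ^ 2 * T = 4 * R ^ 2 := by
    rw [hb, div_pow, Real.sq_sqrt hTpos.le]
    field_simp
    ring
  have hγ' : ∀ t ∈ range T,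
      f / (32 * Lp * b ^ q) * (1 - (q : ℝ) / 2 * ((r t / b) ^ 2 - 1)) ≤ γ t := by
    intro t ht
    have ht := mem_range.1 ht
    have h0 : r t ^ q ≠ 0 := by
      intro h0
      have := hγ t ht
      rw [h0, mul_zero, mul_zero] at this
      linarith
    have hrq : 0 < r t ^ q := lt_of_le_of_ne (pow_nonneg (hr t ht) q) h0.symm
    calc f / (32 * Lp * b ^ q) * (1 - (q : ℝ) / 2 * ((r t / b) ^ 2 - 1))
        ≤ f / (32 * Lp * b ^ q) * ((r t / b) ^ q)⁻¹ := by
          gcongr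
          refine one_sub_mul_sq_sub_one_le_inv_pow (div_nonneg (hr t ht) hbpos.le) ?_
          rw [div_pow]
          positivity
      _ = f / 32 / (Lp * r t ^ q) := by
          rw [div_pow (r t) b]
          field_simp
      _ ≤ γ t := by
          rw [div_le_iff₀ (by positivity)]
          exact hγ t ht
  have hs := sum_le_sum hγ'
  have hs2 : ∑ t ∈ range T, f / (32 * Lp * b ^ q) * (1 - (q : ℝ) / 2 * ((r t / b) ^ 2 - 1)) =
      f / (32 * Lp * b ^ q) * (T - (q : ℝ) / 2 * ((∑ t ∈ range T, r t ^ 2) / b ^ 2 - T)) := by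
    rw [← mul_sum, sum_sub_distrib, ← mul_sum, sum_sub_distrib, sum_div]
    simp [div_pow]
  have h1 : (∑ t ∈ range T, r t ^ 2) / b ^ 2 - T ≤ 0 := by
    rw [sub_nonpos, div_le_iff₀ (by positivity), mul_comm, hb2]
    nlinarith
  have h2 : (q : ℝ) / 2 * ((∑ t ∈ range T, r t ^ 2) / b ^ 2 - T) ≤ 0 :=
    mul_nonpos_of_nonneg_of_nonpos (by positivity) h1
  rw [hs2] at hs
  refine le_trans ?_ hs
  have h3 : (T : ℝ) / b ^ q = √(T : ℝ) ^ (q + 2) / (2 ^ q * R ^ q) := by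
    rw [hb, div_pow, mul_pow, pow_add, Real.sq_sqrt hTpos.le]
    field_simp
  calc 2 / μ = 2 ^ q / (32 * Lp) * (A / (2 ^ q * R ^ q)) := by
        rw [hA]; field_simp; norm_num
    _ ≤ f / (32 * Lp) * (√(T : ℝ) ^ (q + 2) / (2 ^ q * R ^ q)) := by gcongr
    _ = f / (32 * Lp * b ^ q) * T := by rw [← h3]; field_simp
    _ ≤ _ := by gcongr; linarith

/-- Jensen's inequality for the squared distance. -/
theorem sum_mul_norm_average_sub_sq_le {E : Type*} [NormedAddCommGroup E] [NormedSpace ℝ E]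
    {T : ℕ} {γ : ℕ → ℝ} (hγ : ∀ t ∈ range T, 0 ≤ γ t) (hΓ : 0 < ∑ t ∈ range T, γ t)
    (v : ℕ → E) (c : E) :
    (∑ t ∈ range T, γ t) * ‖(∑ t ∈ range T, γ t)⁻¹ • ∑ t ∈ range T, γ t • v t - c‖ ^ 2 ≤
      ∑ t ∈ range T, γ t * ‖v t - c‖ ^ 2 := by
  set Γ := ∑ t ∈ range T, γ t with hΓd
  have e : Γ⁻¹ • ∑ t ∈ range T, γ t • v t - c = Γ⁻¹ • ∑ t ∈ range T, γ t • (v t - c) := by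
    simp_rw [smul_sub, sum_sub_distrib, ← sum_smul, ← hΓd, smul_sub, smul_smul,
      inv_mul_cancel₀ hΓ.ne', one_smul]
  have h1 : ‖∑ t ∈ range T, γ t • (v t - c)‖ ≤ ∑ t ∈ range T, γ t * ‖v t - c‖ := by
    refine (norm_sum_le _ _).trans_eq (sum_congr rfl fun t ht => ?_)
    rw [norm_smul, Real.norm_eq_abs, abs_of_nonneg (hγ t ht)]
  have h2 := sum_sq_le_sum_mul_sum_of_sq_le_mul (range T) (r := fun t => γ t * ‖v t - c‖)
    (f := γ) (g := fun t => γ t * ‖v t - c‖ ^ 2) hγ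
    (fun t ht => mul_nonneg (hγ t ht) (by positivity)) (fun t _ => le_of_eq (by ring))
  have h3 := (pow_le_pow_left₀ (norm_nonneg _) h1 2).trans h2
  rw [e, norm_smul, mul_pow, norm_inv, Real.norm_eq_abs, abs_of_pos hΓ]
  calc Γ * (Γ⁻¹ ^ 2 * ‖∑ t ∈ range T, γ t • (v t - c)‖ ^ 2)
      ≤ Γ * (Γ⁻¹ ^ 2 * (Γ * ∑ t ∈ range T, γ t * ‖v t - c‖ ^ 2)) := by gcongr
    _ = _ := by field_simp

theorem MirrorProxOutput.norm_sub_le_half {p T : ℕ} (hp : 1 ≤ p) (hμ : 0 < μ) (hLp : 0 < Lp)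
    {R : ℝ} (hR : 0 < R)
    (hmono : ∀ z w, μ * ‖z - w‖ ^ 2 ≤ inner ℝ (F z - F w) (z - w))
    (hF : ContDiff ℝ (p - 1 : ℕ) F) (hLip : OrderLipschitz p Lp F) {zs : Pt n m} (hzs : F zs = 0)
    (hT : (64 * Lp * R ^ (p - 1) / μ) ^ (2 / ((p : ℝ) + 1)) ≤ T) {z₁ out : Pt n m}
    (h₁ : ‖z₁ - zs‖ ≤ R) (h : MirrorProxOutput F p Lp T z₁ out) : ‖out - zs‖ ≤ R / 2 := by
  obtain ⟨q, rfl⟩ : ∃ q, p = q + 1 := ⟨p - 1, by omega⟩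
  simp only [Nat.add_sub_cancel] at hT hF
  obtain ⟨z, zh, γ, rfl, ⟨hstep, rfl⟩ | ⟨τ, -, -, h0, rfl⟩⟩ := h
  · have hpos : ∀ t ∈ range T, 0 < γ t := fun t ht => (hstep t (mem_range.1 ht)).pos hLp
    have hsum : μ * ∑ t ∈ range T, γ t * ‖zh t - zs‖ ^ 2 +
        1 / 4 * ∑ t ∈ range T, ‖zh t - z t‖ ^ 2 ≤ 1 / 2 * R ^ 2 := by
      have h1 := sum_le_sum fun t (ht : t ∈ range T) =>
        (hstep t (mem_range.1 ht)).energy_le hLp hmono hF hLip hzs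
      rw [sum_add_distrib, ← mul_sum, ← mul_sum,
        sum_range_sub' (fun t => 1 / 2 * ‖z t - zs‖ ^ 2)] at h1
      have h2 : ‖z 0 - zs‖ ^ 2 ≤ R ^ 2 := pow_le_pow_left₀ (norm_nonneg _) h₁ 2
      have h3 := sq_nonneg ‖z T - zs‖
      linarith
    have hS : 0 ≤ ∑ t ∈ range T, γ t * ‖zh t - zs‖ ^ 2 :=
      sum_nonneg fun t ht => mul_nonneg (hpos t ht).le (by positivity)
    have hr : 0 ≤ ∑ t ∈ range T, ‖zh t - z t‖ ^ 2 := sum_nonneg fun t _ => by positivity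
    have hΓ : 2 / μ ≤ ∑ t ∈ range T, γ t := by
      refine two_div_le_sum_stepSize hμ hLp hR hT (r := fun t => ‖zh t - z t‖)
        (fun t _ => norm_nonneg _) (fun t ht => (hstep t ht).2.1) ?_
      have := mul_nonneg hμ.le hS
      linarith
    have hJ := sum_mul_norm_average_sub_sq_le (fun t ht => (hpos t ht).le)
      (lt_of_lt_of_le (by positivity) hΓ) zh zs
    set d := ‖(∑ t ∈ range T, γ t)⁻¹ • ∑ t ∈ range T, γ t • zh t - zs‖ with hd
    have h1 : μ * (2 / μ * d ^ 2) ≤ 1 / 2 * R ^ 2 := by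
      calc μ * (2 / μ * d ^ 2) ≤ μ * ((∑ t ∈ range T, γ t) * d ^ 2) := by gcongr
        _ ≤ μ * ∑ t ∈ range T, γ t * ‖zh t - zs‖ ^ 2 := by gcongr
        _ ≤ _ := by linarith
    have h2 : μ * (2 / μ * d ^ 2) = 2 * d ^ 2 := by field_simp
    refine le_of_sq_le_sq ?_ (by positivity)
    nlinarith
  · rw [eq_of_stronglyMonotone_of_eq_zero hμ hmono h0 hzs, sub_self, norm_zero]
    positivity

theorem IsRestartRun.norm_sub_le {p N : ℕ} (hp : 1 ≤ p) (hμ : 0 < μ) (hLp : 0 < Lp)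
    {R : ℝ} (hR : 0 < R)
    (hmono : ∀ z w, μ * ‖z - w‖ ^ 2 ≤ inner ℝ (F z - F w) (z - w))
    (hF : ContDiff ℝ (p - 1 : ℕ) F) (hLip : OrderLipschitz p Lp F) {zs : Pt n m} (hzs : F zs = 0)
    {z₁ : Pt n m} (h₁ : ‖z₁ - zs‖ ≤ R) {zt : ℕ → Pt n m}
    (h : IsRestartRun F p Lp μ R N z₁ zt) : ∀ i ≤ N, ‖zt i - zs‖ ≤ R / 2 ^ i := by
  intro i
  induction i with
  | zero => intro _; simpa [h.1] using h₁
  | succ i ih =>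
    intro hi
    have := (h.2 i (by omega)).norm_sub_le_half hp hμ hLp (R := R / 2 ^ i) (by positivity) hmono hF
      hLip hzs (Nat.le_ceil _) (ih (by omega))
    rwa [pow_succ, ← div_div]

end MirrorProx

end TensorSPP

/-! ### The cubic subproblem -/

namespace TensorSPP

section Truncation

variable {E : Type*} [NormedAddCommGroup E] [InnerProductSpace ℝ E]

theorem inner_truncated_sub_nonneg {r : ℝ} (hr : 0 ≤ r) (a b : E) :
    0 ≤ inner ℝ (min ‖a‖ r • a - min ‖b‖ r • b) (a - b) := by
  have ha : 0 ≤ min ‖a‖ r := le_min (norm_nonneg _) hr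
  have hb : 0 ≤ min ‖b‖ r := le_min (norm_nonneg _) hr
  have h1 := real_inner_le_norm a b
  have e : inner ℝ (min ‖a‖ r • a - min ‖b‖ r • b) (a - b) =
      min ‖a‖ r * ‖a‖ ^ 2 + min ‖b‖ r * ‖b‖ ^ 2 - (min ‖a‖ r + min ‖b‖ r) * inner ℝ a b := by
    simp only [inner_sub_left, inner_sub_right, real_inner_smul_left,
      real_inner_self_eq_norm_sq, real_inner_comm a b]
    ring
  have h2 : (min ‖a‖ r + min ‖b‖ r) * inner ℝ a b ≤ (min ‖a‖ r + min ‖b‖ r) * (‖a‖ * ‖b‖) := by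
    gcongr
  have h3 : 0 ≤ (min ‖a‖ r * ‖a‖ - min ‖b‖ r * ‖b‖) * (‖a‖ - ‖b‖) := by
    rcases le_total ‖a‖ ‖b‖ with h | h
    · refine mul_nonneg_of_nonpos_of_nonpos (sub_nonpos.2 ?_) (sub_nonpos.2 h)
      gcongr
    · refine mul_nonneg (sub_nonneg.2 ?_) (sub_nonneg.2 h)
      gcongr
  rw [e]
  nlinarith

theorem norm_truncated_sub_le {r : ℝ} (hr : 0 ≤ r) (a b : E) :
    ‖min ‖a‖ r • a - min ‖b‖ r • b‖ ≤ 2 * r * ‖a - b‖ := by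
  wlog h : ‖a‖ ≤ ‖b‖ generalizing a b
  · rw [norm_sub_rev, norm_sub_rev a b]
    exact this b a (not_le.1 h).le
  have e : min ‖a‖ r • a - min ‖b‖ r • b =
      min ‖b‖ r • (a - b) + (min ‖a‖ r - min ‖b‖ r) • a := by module
  have hb : 0 ≤ min ‖b‖ r := le_min (norm_nonneg _) hr
  have h1 : ‖min ‖b‖ r • (a - b)‖ ≤ r * ‖a - b‖ := by
    rw [norm_smul, Real.norm_eq_abs, abs_of_nonneg hb]
    gcongr
    exact min_le_right _ _
  have h2 : ‖(min ‖a‖ r - min ‖b‖ r) • a‖ ≤ r * ‖a - b‖ := by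
    rw [norm_smul, Real.norm_eq_abs]
    rcases le_total r ‖a‖ with hra | hra
    · rw [min_eq_right hra, min_eq_right (hra.trans h), sub_self, abs_zero, zero_mul]
      positivity
    · calc |min ‖a‖ r - min ‖b‖ r| * ‖a‖ ≤ ‖a - b‖ * r := by
            refine mul_le_mul ?_ hra (norm_nonneg _) (norm_nonneg _)
            have h4 := abs_min_sub_min_le_max ‖a‖ r ‖b‖ r
            rw [sub_self, abs_zero, max_eq_left (abs_nonneg _)] at h4
            exact h4.trans (abs_norm_sub_norm_le a b)
        _ = _ := mul_comm _ _
  rw [e]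
  linarith [norm_add_le (min ‖b‖ r • (a - b)) ((min ‖a‖ r - min ‖b‖ r) • a)]

/-- The cubic regularizer `‖·‖³ / 3` lies above its tangent planes. -/
theorem norm_cube_add_inner_le (a u : E) :
    1 / 3 * ‖a‖ ^ 3 + ‖a‖ * inner ℝ a u ≤ 1 / 3 * ‖a + u‖ ^ 3 := by
  have h1 : inner ℝ a u ≤ ‖a‖ * ‖a + u‖ - ‖a‖ ^ 2 := by
    have := real_inner_le_norm a (a + u)
    rw [inner_add_right, real_inner_self_eq_norm_sq] at this
    linarith
  have ha := norm_nonneg a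
  have hu := norm_nonneg (a + u)
  have h2 : ‖a‖ * inner ℝ a u ≤ ‖a‖ * (‖a‖ * ‖a + u‖ - ‖a‖ ^ 2) := by gcongr
  nlinarith [mul_nonneg (sq_nonneg (‖a + u‖ - ‖a‖)) (by positivity : 0 ≤ ‖a + u‖ + 2 * ‖a‖)]

end Truncation

variable {n m : ℕ}

theorem norm_pt_le (x : Vec n) (y : Vec m) : ‖pt x y‖ ≤ ‖x‖ + ‖y‖ := by
  refine le_of_sq_le_sq ?_ (by positivity)
  rw [WithLp.prod_norm_sq_eq_of_L2]
  have : 0 ≤ ‖x‖ * ‖y‖ := by positivity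
  simp only [WithLp.toLp_fst, WithLp.toLp_snd]
  nlinarith

/-- The operator `d ↦ a + H d + γ (‖dx‖ dx, ‖dy‖ dy)` is not globally Lipschitz. Truncating its
cubic part at the radius `‖a‖ / μ` makes it so, and the zero of the truncated operator lies
within this radius, where the truncation is not felt. -/
theorem exists_cubic_eq_zero {μ γ : ℝ} (hμ : 0 < μ) (hγ : 0 ≤ γ) (a : Pt n m)
    (H : Pt n m →L[ℝ] Pt n m) (hH : ∀ d, μ * ‖d‖ ^ 2 ≤ inner ℝ (H d) d) :
    ∃ d : Pt n m, a + H d + γ • pt (‖d.fst‖ • d.fst) (‖d.snd‖ • d.snd) = 0 ∧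
      ‖d‖ ≤ ‖a‖ / μ := by
  set r := ‖a‖ / μ with hr
  have hr0 : 0 ≤ r := by positivity
  set c : Pt n m → Pt n m := fun d =>
    pt (min ‖d.fst‖ r • d.fst) (min ‖d.snd‖ r • d.snd) with hc
  set Ψ : Pt n m → Pt n m := fun d => a + H d + γ • c d with hΨ
  have hsub : ∀ d e, Ψ d - Ψ e = H (d - e) + γ • (c d - c e) := by
    intro d e
    simp only [hΨ, map_sub, smul_sub]
    abel
  have hcsub : ∀ d e, c d - c e = pt (min ‖d.fst‖ r • d.fst - min ‖e.fst‖ r • e.fst)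
      (min ‖d.snd‖ r • d.snd - min ‖e.snd‖ r • e.snd) := fun d e => rfl
  have hmono : ∀ d e, μ * ‖d - e‖ ^ 2 ≤ inner ℝ (Ψ d - Ψ e) (d - e) := by
    intro d e
    rw [hsub, inner_add_left, real_inner_smul_left, hcsub,
      inner_pt_left (min ‖d.fst‖ r • d.fst - min ‖e.fst‖ r • e.fst)]
    have h1 := inner_truncated_sub_nonneg hr0 d.fst e.fst
    have h2 := inner_truncated_sub_nonneg hr0 d.snd e.snd
    have h3 := mul_nonneg hγ (add_nonneg h1 h2)
    have h4 := hH (d - e)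
    rw [WithLp.sub_fst, WithLp.sub_snd]
    linarith
  have hL : ∀ d e, ‖Ψ d - Ψ e‖ ≤ (‖H‖ + γ * (4 * r)) * ‖d - e‖ := by
    intro d e
    rw [hsub, hcsub]
    have h1 := norm_truncated_sub_le hr0 d.fst e.fst
    have h2 := norm_truncated_sub_le hr0 d.snd e.snd
    have h3 := norm_fst_le (d - e)
    have h4 := norm_snd_le (d - e)
    rw [WithLp.sub_fst] at h3
    rw [WithLp.sub_snd] at h4
    have h5 := norm_pt_le (min ‖d.fst‖ r • d.fst - min ‖e.fst‖ r • e.fst)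
      (min ‖d.snd‖ r • d.snd - min ‖e.snd‖ r • e.snd)
    have h6 : ‖pt (min ‖d.fst‖ r • d.fst - min ‖e.fst‖ r • e.fst)
      (min ‖d.snd‖ r • d.snd - min ‖e.snd‖ r • e.snd)‖ ≤ 4 * r * ‖d - e‖ := by nlinarith
    refine (norm_add_le _ _).trans ?_
    rw [norm_smul, Real.norm_eq_abs, abs_of_nonneg hγ]
    have h7 := H.le_opNorm (d - e)
    have h8 := mul_le_mul_of_nonneg_left h6 hγ
    linarith
  obtain ⟨d, hd⟩ := exists_eq_zero_of_stronglyMonotone hμ hmono hL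
  have hc0 : c 0 = 0 := by
    refine pt_ext ?_ ?_ <;> simp [hc]
  have hΨ0 : Ψ 0 = a := by simp [hΨ, hc0]
  have hdr : ‖d‖ ≤ r := by
    have h := norm_le_div_of_stronglyMonotone hμ (Ψ := Ψ) (a := d)
      (by simpa using hmono d 0) hd
    rwa [hΨ0] at h
  refine ⟨d, ?_, hdr⟩
  have h1 : min ‖d.fst‖ r = ‖d.fst‖ := min_eq_left ((norm_fst_le d).trans hdr)
  have h2 : min ‖d.snd‖ r = ‖d.snd‖ := min_eq_left ((norm_snd_le d).trans hdr)
  simpa only [hΨ, hc, h1, h2] using hd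

theorem norm_pt_norm_smul_le (d : Pt n m) :
    ‖pt (‖d.fst‖ • d.fst) (‖d.snd‖ • d.snd)‖ ≤ ‖d‖ ^ 2 := by
  refine le_of_sq_le_sq ?_ (by positivity)
  rw [WithLp.prod_norm_sq_eq_of_L2, WithLp.prod_norm_sq_eq_of_L2]
  simp only [WithLp.toLp_fst, WithLp.toLp_snd, norm_smul, norm_norm]
  nlinarith [mul_nonneg (sq_nonneg ‖d.fst‖) (sq_nonneg ‖d.snd‖)]

section Cubic

variable {g : Pt n m → ℝ} {μ : ℝ}

theorem cubicModel_add (w d : Pt n m) (γ : ℝ) :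
    cubicModel g w γ (w + d) = g w + fderiv ℝ g w d + 1 / 2 * fderiv ℝ (fderiv ℝ g) w d d
      + γ * (1 / 3 * ‖d.fst‖ ^ 3) - γ * (1 / 3 * ‖d.snd‖ ^ 3) := by
  simp only [cubicModel, taylorApprox, Finset.sum_range_succ, Finset.sum_range_zero,
    iteratedFDeriv_zero_apply, iteratedFDeriv_one_apply, iteratedFDeriv_two_apply,
    add_sub_cancel_left, WithLp.add_fst, WithLp.add_snd, Nat.factorial, smul_eq_mul]
  push_cast
  ring

/-- The first-order condition of the cubic subproblem is solvable, and since the model is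
`μ`-strongly convex-concave, its solution is the only saddle point. -/
theorem exists_unique_cubicModel_saddle (hpos : 0 < μ) (hμ : StronglyConvexConcave μ g)
    (hg : ContDiff ℝ 2 g) (w : Pt n m) {γ : ℝ} (hγ : 0 ≤ γ) :
    ∃ d, IsSaddlePoint (cubicModel g w γ) (w + d) ∧
      (∀ s, IsSaddlePoint (cubicModel g w γ) s → s = w + d) ∧
      ‖d‖ ≤ ‖saddleOp g w‖ / μ ∧
      ‖saddleOp g w + fderiv ℝ (saddleOp g) w d‖ ≤ γ * ‖d‖ ^ 2 := by
  have hdiff : Differentiable ℝ g := hg.differentiable (by simp)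
  have hF : DifferentiableAt ℝ (saddleOp g) w :=
    ((contDiff_saddleOp (q := 1) hg).differentiable (by simp)).differentiableAt
  have hH := inner_fderiv_ge_of_stronglyMonotone (hμ.stronglyMonotone hdiff) hF
  have hsymm : ∀ a b, fderiv ℝ (fderiv ℝ g) w a b = fderiv ℝ (fderiv ℝ g) w b a := fun a b =>
    (hg.contDiffAt.isSymmSndFDerivAt (by simp)).eq a b
  obtain ⟨d, hd, hdn⟩ := exists_cubic_eq_zero hpos hγ (saddleOp g w) (fderiv ℝ (saddleOp g) w) hH
  have hEq : ∀ v, fderiv ℝ g w (reflectY n m v) + fderiv ℝ (fderiv ℝ g) w d (reflectY n m v) +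
      γ * (‖d.fst‖ * inner ℝ d.fst v.fst + ‖d.snd‖ * inner ℝ d.snd v.snd) = 0 := by
    intro v
    have h := congrArg (fun z => inner ℝ z v) hd
    simpa only [inner_add_left, inner_saddleOp hdiff, inner_fderiv_saddleOp hg,
      real_inner_smul_left, inner_pt_left, inner_zero_left] using h
  have hX : ∀ u, reflectY n m (embX n m u) = embX n m u := fun u =>
    pt_ext (by simp [reflectY_apply, embX_apply]) (by simp [reflectY_apply, embX_apply])
  have hY : ∀ v, reflectY n m (embY n m v) = -embY n m v := fun v =>
    pt_ext (by simp [reflectY_apply, embY_apply]) (by simp [reflectY_apply, embY_apply])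
  have hs := isSaddlePoint_and_unique_of_quadratic_growth (h := cubicModel g w γ) (z := w + d)
    hpos ?_ ?_
  · refine ⟨d, hs.1, hs.2, hdn, ?_⟩
    rw [eq_neg_of_add_eq_zero_left hd, norm_neg, norm_smul, Real.norm_eq_abs, abs_of_nonneg hγ]
    gcongr
    exact norm_pt_norm_smul_le d
  · intro x'
    set u := x' - (w + d).fst with hu
    have e : pt x' (w + d).snd = w + (d + embX n m u) := by
      refine pt_ext ?_ ?_
      · simp only [embX_apply, hu, WithLp.add_fst, WithLp.toLp_fst]; abel
      · simp only [embX_apply, WithLp.add_snd, WithLp.toLp_snd, add_zero]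
    have h1 := hEq (embX n m u)
    have h2 := hH (embX n m u)
    rw [inner_fderiv_saddleOp hg] at h2
    rw [hX] at h1 h2
    have hf : (embX n m u).fst = u := rfl
    have hs : (embX n m u).snd = 0 := rfl
    have hn : ‖embX n m u‖ ^ 2 = ‖u‖ ^ 2 := by
      rw [WithLp.prod_norm_sq_eq_of_L2, hf, hs]; simp
    have h3 := mul_le_mul_of_nonneg_left (norm_cube_add_inner_le d.fst u) hγ
    rw [e, cubicModel_add, cubicModel_add, WithLp.add_fst, WithLp.add_snd, hf, hs, add_zero]
    simp only [map_add, add_apply]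
    rw [hf, hs, inner_zero_right] at h1
    rw [hn] at h2
    rw [hsymm (embX n m u) d]
    linarith
  · intro y'
    set v := y' - (w + d).snd with hv
    have e : pt (w + d).fst y' = w + (d + embY n m v) := by
      refine pt_ext ?_ ?_
      · simp only [embY_apply, WithLp.add_fst, WithLp.toLp_fst, add_zero]
      · simp only [embY_apply, hv, WithLp.add_snd, WithLp.toLp_snd]; abel
    have h1 := hEq (embY n m v)
    have h2 := hH (embY n m v)
    rw [inner_fderiv_saddleOp hg] at h2
    rw [hY] at h1 h2
    have hf : (embY n m v).fst = 0 := rfl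
    have hs : (embY n m v).snd = v := rfl
    have hn : ‖embY n m v‖ ^ 2 = ‖v‖ ^ 2 := by
      rw [WithLp.prod_norm_sq_eq_of_L2, hf, hs]; simp
    have h3 := mul_le_mul_of_nonneg_left (norm_cube_add_inner_le d.snd v) hγ
    rw [e, cubicModel_add, cubicModel_add, WithLp.add_fst, WithLp.add_snd, hf, hs, add_zero]
    simp only [map_add, add_apply]
    rw [hf, hs, inner_zero_right] at h1
    simp only [map_neg] at h1 h2
    rw [hn] at h2
    rw [hsymm (embY n m v) d]
    linarith

/-! ### Quadratic convergence of CRN-SPP -/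

theorem norm_saddleOp_add_le (hg : ContDiff ℝ 2 g) {L₂ : ℝ}
    (hL₂ : OrderLipschitz 2 L₂ (saddleOp g)) (w d : Pt n m) :
    ‖saddleOp g (w + d)‖ ≤
      ‖saddleOp g w + fderiv ℝ (saddleOp g) w d‖ + L₂ / 2 * ‖d‖ ^ 2 := by
  have h := norm_sub_taylorApprox_le (contDiff_saddleOp (q := 1) hg) (M := L₂) hL₂ w (w + d)
  have e : taylorApprox (saddleOp g) 1 w (w + d) =
      saddleOp g w + fderiv ℝ (saddleOp g) w d := by
    simp [taylorApprox, Finset.sum_range_succ]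
  rw [e, add_sub_cancel_left] at h
  have h2 := norm_le_norm_add_norm_sub' (saddleOp g (w + d))
    (saddleOp g w + fderiv ℝ (saddleOp g) w d)
  norm_num at h
  linarith

theorem norm_saddleOp_le_of_merit_le {z w : Pt n m} (h : merit g z ≤ merit g w) :
    ‖saddleOp g z‖ ≤ ‖saddleOp g w‖ := by
  unfold merit at h
  exact le_of_sq_le_sq (by linarith) (norm_nonneg _)

/-- One iteration is quadratically contracting; choosing between the damped and the full step can
only decrease the merit further. -/
theorem CRNStep.norm_saddleOp_le (hpos : 0 < μ) (hμ : StronglyConvexConcave μ g)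
    (hg : ContDiff ℝ 2 g) {L₂ γbar ρ α : ℝ} (hL₂ : OrderLipschitz 2 L₂ (saddleOp g))
    (hγ : 0 < γbar) (hγL : γbar ≤ L₂ / 2) (hρ : 0 < ρ) (hρ1 : ρ < 1) {w w' : Pt n m}
    (h : CRNStep g μ γbar ρ α w w') :
    ‖saddleOp g w'‖ ≤ L₂ * (‖saddleOp g w‖ / μ) ^ 2 := by
  obtain ⟨j, s, hs, -, -, hw'⟩ := h
  have hγj : 0 < ρ ^ j * γbar := by positivity
  have hγj' : ρ ^ j * γbar ≤ L₂ / 2 :=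
    (mul_le_of_le_one_left hγ.le (pow_le_one₀ hρ.le hρ1.le)).trans hγL
  obtain ⟨d, -, hu, hd, hr⟩ := exists_unique_cubicModel_saddle hpos hμ hg w hγj.le
  have hsj : s j - w = d := by rw [hu _ (hs j le_rfl), add_sub_cancel_left]
  have hw : ‖saddleOp g w'‖ ≤ ‖saddleOp g (w + d)‖ := by
    rw [hsj] at hw'
    rcases hw' with ⟨h1, rfl⟩ | ⟨-, rfl⟩
    · exact norm_saddleOp_le_of_merit_le h1.le
    · exact le_rfl
  have h1 := norm_saddleOp_add_le hg hL₂ w d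
  have h2 : ‖d‖ ^ 2 ≤ (‖saddleOp g w‖ / μ) ^ 2 := pow_le_pow_left₀ (norm_nonneg _) hd 2
  have h3 : ρ ^ j * γbar * ‖d‖ ^ 2 ≤ L₂ / 2 * ‖d‖ ^ 2 := by gcongr
  have hL : 0 < L₂ := by linarith
  have h4 : L₂ * ‖d‖ ^ 2 ≤ L₂ * (‖saddleOp g w‖ / μ) ^ 2 := by gcongr
  linarith

/-- Close to the solution, already the first trial `γ = γbar` is accepted. -/
theorem exists_CRNStep (hpos : 0 < μ) (hμ : StronglyConvexConcave μ g)
    (hg : ContDiff ℝ 2 g) {γbar : ℝ} (hγ : 0 < γbar) {w : Pt n m}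
    (hw : γbar * (2 * (‖saddleOp g w‖ / μ)) ≤ μ) (ρ α : ℝ) :
    ∃ w', CRNStep g μ γbar ρ α w w' := by
  obtain ⟨d, hs, -, hd, -⟩ := exists_unique_cubicModel_saddle hpos hμ hg w hγ.le
  have hacc : γbar * (‖d.fst‖ + ‖d.snd‖) ≤ μ := by
    refine le_trans ?_ hw
    gcongr
    linarith [norm_fst_le d, norm_snd_le d]
  by_cases hm : merit g (w + α • d) < merit g (w + d)
  · refine ⟨w + α • d, 0, fun _ => w + d, ?_, by simp, by simpa using hacc, Or.inl ?_⟩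
    · intro i hi
      obtain rfl : i = 0 := by omega
      simpa using hs
    · simpa using hm
  · refine ⟨w + d, 0, fun _ => w + d, ?_, by simp, by simpa using hacc, Or.inr ?_⟩
    · intro i hi
      obtain rfl : i = 0 := by omega
      simpa using hs
    · simpa using hm

theorem IsCRNRun.norm_saddleOp_le (hpos : 0 < μ) (hμ : StronglyConvexConcave μ g)
    (hg : ContDiff ℝ 2 g) {L₂ γbar ρ α ε : ℝ} (hL₂pos : 0 < L₂)
    (hL₂ : OrderLipschitz 2 L₂ (saddleOp g))
    (hγ : 0 < γbar) (hγL : γbar ≤ L₂ / 2) (hρ : 0 < ρ) (hρ1 : ρ < 1) {w₀ : Pt n m}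
    (h₀ : ‖saddleOp g w₀‖ ≤ μ ^ 2 / (2 * L₂)) {k : ℕ} {w : ℕ → Pt n m}
    (h : IsCRNRun g μ γbar ρ α ε w₀ k w) :
    ∀ j ≤ k, ‖saddleOp g (w j)‖ ≤ μ ^ 2 / L₂ * (1 / 2) ^ 2 ^ j := by
  intro j
  induction j with
  | zero =>
    intro _
    rw [h.1]
    refine h₀.trans_eq ?_
    field_simp
    norm_num
  | succ j ih =>
    intro hj
    have h1 := (h.2 j (by omega)).2.norm_saddleOp_le hpos hμ hg hL₂ hγ hγL hρ hρ1
    have h2 := ih (by omega)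
    calc ‖saddleOp g (w (j + 1))‖ ≤ L₂ * (‖saddleOp g (w j)‖ / μ) ^ 2 := h1
      _ ≤ L₂ * (μ ^ 2 / L₂ * (1 / 2) ^ 2 ^ j / μ) ^ 2 := by gcongr
      _ = μ ^ 2 / L₂ * ((1 / 2) ^ 2 ^ j) ^ 2 := by field_simp
      _ = _ := by rw [← pow_mul, ← pow_succ]

end Cubic

end TensorSPP

/-! ### Counting iterations -/

namespace TensorSPP

/-- A doubly logarithmic count: rescaling `log (1 / ε)` by the constant `1 / l` costs no more than a
factor `2` in its logarithm once `ε` is small. -/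
theorem exists_threshold_iteration_bound {A B l : ℝ} (hA : 0 < A) (hB : 0 < B) (hl : 0 < l) :
    ∃ ε₀ : ℝ, 0 < ε₀ ∧ ∀ ε, 0 < ε → ε ≤ ε₀ →
      0 ≤ Real.logb 2 (Real.log (B / ε) / l) ∧
      ∀ k : ℕ, 2 ^ k * Real.log 2 < Real.log (A / ε) →
        (k : ℝ) ≤ 2 * (1 + Real.logb 2 (Real.log (B / ε) / l)) := by
  -- With `X = log (1 / ε)` and `Y = log (B / ε) / l`, the four summands ensure `X + log A ≤ 2 X`,
  -- `X / (2 l) ≤ Y`, `4 X ≤ (X / l)²` and `1 ≤ Y`.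
  refine ⟨Real.exp (-(|Real.log A| + 2 * |Real.log B| + 4 * l ^ 2 + 2 * l)), Real.exp_pos _,
    fun ε hε hε₀ => ?_⟩
  set X := -Real.log ε with hX
  have hXge : |Real.log A| + 2 * |Real.log B| + 4 * l ^ 2 + 2 * l ≤ X := by
    have := Real.log_le_log hε hε₀
    rw [Real.log_exp] at this
    linarith
  have a1 := le_abs_self (Real.log A)
  have a2 := neg_abs_le (Real.log B)
  have a3 := abs_nonneg (Real.log A)
  have a4 := abs_nonneg (Real.log B)
  have hXpos : 0 < X := by nlinarith
  set Y := Real.log (B / ε) / l with hY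
  have hYX : X / (2 * l) ≤ Y := by
    rw [hY, Real.log_div hB.ne' hε.ne', div_le_div_iff₀ (by positivity) hl]
    nlinarith
  have hY1 : 1 ≤ Y := by
    refine le_trans ?_ hYX
    rw [one_le_div (by positivity)]
    nlinarith
  have hYpos : 0 < Y := by linarith
  refine ⟨Real.logb_nonneg one_lt_two hY1, fun k hk => ?_⟩
  rw [Real.log_div hA.ne' hε.ne'] at hk
  have h2 : (2 : ℝ) ^ k < 4 * X := by
    have h3 : (2 : ℝ) ^ k * (1 / 2) ≤ 2 ^ k * Real.log 2 := by
      gcongr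
      linarith [Real.log_two_gt_d9]
    nlinarith
  have h3 : 4 * X ≤ (2 * Y) ^ 2 := by
    have h4 : X / l ≤ 2 * Y := by
      calc X / l = 2 * (X / (2 * l)) := by field_simp
        _ ≤ _ := by gcongr
    refine le_trans ?_ (pow_le_pow_left₀ (by positivity) h4 2)
    rw [div_pow, le_div_iff₀ (by positivity)]
    nlinarith
  calc (k : ℝ) = Real.logb 2 (2 ^ k) := by
        rw [← Real.rpow_natCast, Real.logb_rpow two_pos (by norm_num)]
    _ ≤ Real.logb 2 ((2 * Y) ^ 2) :=
        Real.logb_le_logb_of_le one_lt_two (by positivity) (h2.le.trans h3)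
    _ = 2 * (1 + Real.logb 2 Y) := by
        rw [Real.logb_pow, Real.logb_mul two_ne_zero hYpos.ne',
          Real.logb_self_eq_one one_lt_two]
        norm_num

theorem restartLength_le {p : ℕ} (hp : 1 ≤ p) {Lp μ R : ℝ} (hLp : 0 < Lp) (hμ : 0 < μ)
    (hR : 0 < R) (i : ℕ) :
    (restartLength p Lp μ R i : ℝ) ≤
      65 * max 1 ((Lp * R ^ (p - 1) / μ) ^ (2 / ((p : ℝ) + 1))) := by
  set e : ℝ := 2 / ((p : ℝ) + 1) with he
  have hp' : (1 : ℝ) ≤ p := by exact_mod_cast hp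
  have he0 : 0 ≤ e := by positivity
  have he1 : e ≤ 1 := by
    rw [he, div_le_one (by positivity)]
    linarith
  have hx : (64 * Lp * (R / 2 ^ i) ^ (p - 1) / μ) ^ e ≤ 64 * (Lp * R ^ (p - 1) / μ) ^ e := by
    calc (64 * Lp * (R / 2 ^ i) ^ (p - 1) / μ) ^ e ≤ (64 * (Lp * R ^ (p - 1) / μ)) ^ e := by
          refine Real.rpow_le_rpow (by positivity) ?_ he0
          rw [mul_assoc, mul_div_assoc]
          gcongr
          exact div_le_self hR.le (one_le_pow₀ one_le_two)
      _ = 64 ^ e * (Lp * R ^ (p - 1) / μ) ^ e := Real.mul_rpow (by norm_num) (by positivity)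
      _ ≤ 64 * (Lp * R ^ (p - 1) / μ) ^ e := by
          gcongr
          exact Real.rpow_le_self_of_one_le (by norm_num) he1
  have h1 := (Nat.ceil_lt_add_one (by positivity :
    0 ≤ (64 * Lp * (R / 2 ^ i) ^ (p - 1) / μ) ^ e)).le
  have h2 := le_max_left 1 ((Lp * R ^ (p - 1) / μ) ^ e)
  have h3 := le_max_right 1 ((Lp * R ^ (p - 1) / μ) ^ e)
  rw [restartLength, ← he]
  linarith

theorem numRestarts_le (μ L₁ L₂ R : ℝ) :
    (numRestarts μ L₁ L₂ R : ℝ) ≤ 3 * max 1 (Real.logb 2 (L₂ * xi μ L₁ * R / μ)) := by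
  have e : L₂ * R * xi μ L₁ / μ = L₂ * xi μ L₁ * R / μ := by ring
  rw [numRestarts, e]
  have h2 := le_max_left 1 (Real.logb 2 (L₂ * xi μ L₁ * R / μ))
  have h3 := le_max_right 1 (Real.logb 2 (L₂ * xi μ L₁ * R / μ))
  rcases le_total (Real.logb 2 (L₂ * xi μ L₁ * R / μ) + 1) 0 with h | h
  · rw [Nat.ceil_eq_zero.2 h]
    push_cast
    linarith
  · have := (Nat.ceil_lt_add_one h).le
    linarith

theorem sum_restartLength_le {p : ℕ} (hp : 1 ≤ p) {Lp μ R : ℝ} (hLp : 0 < Lp) (hμ : 0 < μ)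
    (hR : 0 < R) (L₁ L₂ : ℝ) :
    ((∑ i ∈ Finset.range (numRestarts μ L₁ L₂ R), restartLength p Lp μ R i : ℕ) : ℝ) ≤
      195 * (max 1 ((Lp * R ^ (p - 1) / μ) ^ (2 / ((p : ℝ) + 1))) *
        max 1 (Real.logb 2 (L₂ * xi μ L₁ * R / μ))) := by
  rw [Nat.cast_sum]
  refine (Finset.sum_le_card_nsmul _ _ _ fun i _ => restartLength_le hp hLp hμ hR i).trans ?_
  rw [Finset.card_range, nsmul_eq_mul]
  have h := numRestarts_le μ L₁ L₂ R
  set M₁ := max 1 ((Lp * R ^ (p - 1) / μ) ^ (2 / ((p : ℝ) + 1)))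
  have hM : 0 < M₁ := lt_of_lt_of_le one_pos (le_max_left _ _)
  calc (numRestarts μ L₁ L₂ R : ℝ) * (65 * M₁)
      ≤ (3 * max 1 (Real.logb 2 (L₂ * xi μ L₁ * R / μ))) * (65 * M₁) := by gcongr
    _ = _ := by ring

theorem xi_pos (μ L₁ : ℝ) : 0 < xi μ L₁ := lt_of_lt_of_le one_pos (le_max_left _ _)

theorem div_two_pow_numRestarts_le {μ L₁ L₂ R : ℝ} (hμ : 0 < μ) (hL₂ : 0 < L₂) (hR : 0 < R) :
    R / 2 ^ numRestarts μ L₁ L₂ R ≤ μ / (2 * (L₂ * xi μ L₁)) := by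
  have hξ := xi_pos μ L₁
  have h1 : Real.logb 2 (L₂ * R * xi μ L₁ / μ) + 1 ≤ numRestarts μ L₁ L₂ R := Nat.le_ceil _
  have h2 := Real.rpow_le_rpow_of_exponent_le one_le_two h1
  rw [Real.rpow_add two_pos, Real.rpow_logb two_pos (by norm_num) (by positivity), Real.rpow_one,
    Real.rpow_natCast] at h2
  rw [div_le_div_iff₀ (by positivity) (by positivity)]
  calc R * (2 * (L₂ * xi μ L₁)) = μ * (L₂ * R * xi μ L₁ / μ * 2) := by field_simp
    _ ≤ _ := by gcongr

end TensorSPP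

theorem theorem3 :
    ∃ K : ℝ, 0 < K ∧
      ∀ μ L₁ L₂ : ℝ, 0 < μ → 0 < L₁ → 0 < L₂ → μ ^ 2 < L₁ * L₂ →
      ∃ ε₀ : ℝ, 0 < ε₀ ∧
        ∀ (n m p : ℕ) (Lp R : ℝ) (g : TensorSPP.Pt n m → ℝ) (z₁ : TensorSPP.Pt n m) (ε ρ α : ℝ),
          1 ≤ p → 0 < Lp → 0 < R → 0 < ε → ε < 1 → 0 < ρ → ρ < 1 → 0 < α → α < 1 →
          -- assumptions on the objective
          ContDiff ℝ p g → ContDiff ℝ 2 g →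
          TensorSPP.StronglyConvexConcave μ g →
          TensorSPP.OrderLipschitz 1 L₁ (TensorSPP.saddleOp g) →
          TensorSPP.OrderLipschitz 2 L₂ (TensorSPP.saddleOp g) →
          TensorSPP.OrderLipschitz p Lp (TensorSPP.saddleOp g) →
          -- `R` bounds the distance from the starting point to the solution
          (∀ zs, TensorSPP.IsSaddlePoint g zs → ‖z₁ - zs‖ ≤ R) →
          -- the restarts of HighOrderMirrorProx
          ∀ zt : ℕ → TensorSPP.Pt n m,
            TensorSPP.IsRestartRun (TensorSPP.saddleOp g) p Lp μ R
              (TensorSPP.numRestarts μ L₁ L₂ R) z₁ zt →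
            -- they end in the region of quadratic convergence
            (∀ zs, TensorSPP.IsSaddlePoint g zs →
              ‖zt (TensorSPP.numRestarts μ L₁ L₂ R) - zs‖ ≤ μ / (L₂ * TensorSPP.xi μ L₁)) ∧
            -- `k` iterations of CRN-SPP from the point reached
            ∀ (k : ℕ) (w : ℕ → TensorSPP.Pt n m),
              TensorSPP.IsCRNRun g μ (L₂ * μ ^ 2 / (2 * L₁ ^ 2)) ρ α (μ ^ 2 * ε / L₁)
                (zt (TensorSPP.numRestarts μ L₁ L₂ R)) k w →
              -- if the method has not stopped, the next iteration is possible
              (μ ^ 2 * ε / L₁ < TensorSPP.merit g (w k) →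
                ∃ w', TensorSPP.CRNStep g μ (L₂ * μ ^ 2 / (2 * L₁ ^ 2)) ρ α (w k) w') ∧
              -- if the method has stopped, the duality gap is at most `ε`
              (TensorSPP.merit g (w k) ≤ μ ^ 2 * ε / L₁ →
                ∃ G, TensorSPP.IsDualityGap g (w k) G ∧ G ≤ ε) ∧
              -- bound for the total number of iterations
              (ε ≤ ε₀ →
                ((∑ i ∈ Finset.range (TensorSPP.numRestarts μ L₁ L₂ R),
                    TensorSPP.restartLength p Lp μ R i : ℕ) : ℝ) + (k : ℝ) ≤
                  K * (max 1 ((Lp * R ^ (p - 1) / μ) ^ (2 / ((p : ℝ) + 1))) *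
                        max 1 (Real.logb 2 (L₂ * TensorSPP.xi μ L₁ * R / μ)) +
                      Real.logb 2 (Real.log (L₁ ^ 3 / (2 * μ ^ 2 * ε)) /
                        Real.log (L₁ * L₂ / μ ^ 2)))) := by
  refine ⟨200, by norm_num, fun μ L₁ L₂ hμ hL₁ hL₂ hμL => ?_⟩
  have hlog : 0 < Real.log (L₁ * L₂ / μ ^ 2) :=
    Real.log_pos ((one_lt_div (by positivity)).2 hμL)
  obtain ⟨ε₀, hε₀, hcount⟩ := TensorSPP.exists_threshold_iteration_bound
    (A := L₁ * μ ^ 2 / (2 * L₂ ^ 2)) (B := L₁ ^ 3 / (2 * μ ^ 2)) (by positivity) (by positivity)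
    hlog
  refine ⟨ε₀, hε₀, ?_⟩
  intro n m p Lp R g z₁ ε ρ α hp hLp hR hε hε1 hρ hρ1 hα hα1 hgp hg2 hscc hLip1 hLip2 hLipp hz₁
    zt hzt
  have hdiff : Differentiable ℝ g := hg2.differentiable (by simp)
  have hmono := hscc.stronglyMonotone hdiff
  obtain ⟨zs, hFzs, hsad, huniq⟩ := TensorSPP.exists_isSaddlePoint hμ hscc hdiff hLip1
  have hF : ContDiff ℝ (p - 1 : ℕ) (TensorSPP.saddleOp g) :=
    TensorSPP.contDiff_saddleOp (by rwa [Nat.sub_add_cancel hp])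
  have hξ := TensorSPP.xi_pos μ L₁
  have hend := (hzt.norm_sub_le hp hμ hLp hR hmono hF hLipp hFzs (hz₁ zs hsad) _ le_rfl).trans
    (TensorSPP.div_two_pow_numRestarts_le (L₁ := L₁) hμ hL₂ hR)
  refine ⟨fun s hs => ?_, fun k w hw => ?_⟩
  · rw [huniq s hs]
    have hpos := mul_pos hL₂ hξ
    exact hend.trans (div_le_div_of_nonneg_left hμ.le hpos (by linarith))
  set γbar := L₂ * μ ^ 2 / (2 * L₁ ^ 2) with hγbar
  have hγpos : 0 < γbar := by positivity
  have h₀ : ‖TensorSPP.saddleOp g (zt (TensorSPP.numRestarts μ L₁ L₂ R))‖ ≤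
      μ ^ 2 / (2 * L₂) := by
    have h1 := hLip1.norm_sub_le (zt (TensorSPP.numRestarts μ L₁ L₂ R)) zs
    rw [hFzs, sub_zero] at h1
    have h2 : L₁ / μ ≤ TensorSPP.xi μ L₁ := le_max_right _ _
    calc _ ≤ L₁ * ‖zt (TensorSPP.numRestarts μ L₁ L₂ R) - zs‖ := h1
      _ ≤ L₁ * (μ / (2 * (L₂ * TensorSPP.xi μ L₁))) := by gcongr
      _ ≤ L₁ * (μ / (2 * (L₂ * (L₁ / μ)))) := by gcongr
      _ = _ := by field_simp
  -- in dimension `0` the Lipschitz constant may be smaller than `μ`, but then the merit vanishes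
  have hμL₁ : ∀ z, 0 < TensorSPP.merit g z → μ ≤ L₁ := by
    intro z hz
    have hne : z ≠ zs := by
      rintro rfl
      simp [TensorSPP.merit, hFzs] at hz
    have hpos : 0 < ‖z - zs‖ := norm_pos_iff.2 (sub_ne_zero.2 hne)
    have h1 := hmono z zs
    have h2 := real_inner_le_norm (TensorSPP.saddleOp g z - TensorSPP.saddleOp g zs) (z - zs)
    have h3 := mul_le_mul_of_nonneg_right (hLip1.norm_sub_le z zs) hpos.le
    refine le_of_mul_le_mul_right ?_ (pow_pos hpos 2)
    linarith
  have hγL : μ ≤ L₁ → γbar ≤ L₂ / 2 := by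
    intro h
    rw [hγbar, div_le_div_iff₀ (by positivity) two_pos]
    have : μ ^ 2 ≤ L₁ ^ 2 := by gcongr
    nlinarith
  have htol : 0 < μ ^ 2 * ε / L₁ := by positivity
  refine ⟨fun hk => ?_, fun hk => ?_, fun hεε₀ => ?_⟩
  · have hle := hμL₁ _ (htol.trans hk)
    refine TensorSPP.exists_CRNStep hμ hscc hg2 hγpos ?_ ρ α
    have h1 := hw.norm_saddleOp_le hμ hscc hg2 hL₂ hLip2 hγpos (hγL hle) hρ hρ1 h₀ k le_rfl
    have h2 : ((1 : ℝ) / 2) ^ 2 ^ k ≤ 1 := pow_le_one₀ (by norm_num) (by norm_num)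
    calc γbar * (2 * (‖TensorSPP.saddleOp g (w k)‖ / μ))
        ≤ γbar * (2 * (μ ^ 2 / L₂ * 1 / μ)) := by
          gcongr
          exact h1.trans (by gcongr)
      _ = μ * (μ ^ 2 / L₁ ^ 2) := by rw [hγbar]; field_simp
      _ ≤ μ * 1 := by
          gcongr
          rw [div_le_one (by positivity)]
          gcongr
      _ = μ := mul_one μ
  · obtain ⟨G, hG, hGle⟩ := TensorSPP.exists_isDualityGap_le hμ hscc hdiff hLip1 (w k)
    refine ⟨G, hG, hGle.trans ?_⟩
    by_cases h0 : 0 < TensorSPP.merit g (w k)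
    · have hle := hμL₁ _ h0
      rw [div_le_iff₀ hμ]
      refine hk.trans ?_
      rw [div_le_iff₀ hL₁]
      calc μ ^ 2 * ε = ε * μ * μ := by ring
        _ ≤ ε * μ * L₁ := by gcongr
    · exact (div_nonpos_of_nonpos_of_nonneg (not_lt.1 h0) hμ.le).trans hε.le
  · obtain ⟨hnn, hbound⟩ := hcount ε hε hεε₀
    rw [div_div (L₁ ^ 3)] at hnn hbound
    have hsum := TensorSPP.sum_restartLength_le hp hLp hμ hR L₁ L₂
    have hM₁ := le_max_left 1 ((Lp * R ^ (p - 1) / μ) ^ (2 / ((p : ℝ) + 1)))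
    have hM₂ := le_max_left 1 (Real.logb 2 (L₂ * TensorSPP.xi μ L₁ * R / μ))
    have hM := one_le_mul_of_one_le_of_one_le hM₁ hM₂
    have hk : (k : ℝ) ≤ 2 * (1 + Real.logb 2 (Real.log (L₁ ^ 3 / (2 * μ ^ 2 * ε)) /
        Real.log (L₁ * L₂ / μ ^ 2))) := by
      rcases Nat.eq_zero_or_pos k with rfl | hkpos
      · push_cast
        linarith
      obtain ⟨j, rfl⟩ : ∃ j, k = j + 1 := ⟨k - 1, by omega⟩
      refine hbound (j + 1) ?_
      have hj := (hw.2 j (by omega)).1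
      have hle := hμL₁ _ (htol.trans hj)
      have h1 := hw.norm_saddleOp_le hμ hscc hg2 hL₂ hLip2 hγpos (hγL hle) hρ hρ1 h₀ j (by omega)
      have h2 : μ ^ 2 * ε / L₁ < μ ^ 4 / (2 * L₂ ^ 2) * (1 / 2) ^ 2 ^ (j + 1) := by
        refine hj.trans_le ?_
        calc TensorSPP.merit g (w j)
            ≤ 1 / 2 * (μ ^ 2 / L₂ * (1 / 2) ^ 2 ^ j) ^ 2 := by
              rw [TensorSPP.merit]; gcongr
          _ = _ := by rw [mul_pow, ← pow_mul, ← pow_succ]; ring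
      have h3 : (2 : ℝ) ^ 2 ^ (j + 1) < L₁ * μ ^ 2 / (2 * L₂ ^ 2) / ε := by
        rw [div_pow, one_pow, mul_one_div, lt_div_iff₀ (by positivity)] at h2
        rw [lt_div_iff₀ hε]
        calc (2 : ℝ) ^ 2 ^ (j + 1) * ε
            = L₁ / μ ^ 2 * (μ ^ 2 * ε / L₁ * 2 ^ 2 ^ (j + 1)) := by field_simp
          _ < L₁ / μ ^ 2 * (μ ^ 4 / (2 * L₂ ^ 2)) := by gcongr
          _ = _ := by field_simp
      have h4 := Real.log_lt_log (by positivity) h3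
      rw [Real.log_pow] at h4
      exact_mod_cast h4
    linarith
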